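/- Consider signatures consisting of a set $\tau_0$ of unary symbols, the four navigational binary symbols ${\downarrow},{\downarrow^+},{\rightarrow},{\rightarrow^+}$, and a set $\tau_{com}$ of further (uninterpreted) binary symbols. Formulas are interpreted over finite nonempty unranked ordered trees, where ${\downarrow}$ is the child relation, ${\rightarrow}$ the right-sibling relation, and ${\downarrow^+},{\rightarrow^+}$ are their transitive closures. The ten order formulas are $x{\downarrow}y$, $y{\downarrow}x$, $x{\downarrow^+}y\wedge\neg x{\downarrow}y$, $y{\downarrow^+}x\wedge\neg y{\downarrow}x$, $x{\rightarrow}y$, $y{\rightarrow}x$, $x{\rightarrow^+}y\wedge\neg x{\rightarrow}y$, $y{\rightarrow^+}x\wedge\neg y{\rightarrow}x$, $x=y$, and "$x\neq y$ and $x,y$ are related by no navigational symbol". A formula $\varphi$ of $\mathrm{FO}^2[{\downarrow},{\downarrow^+},{\rightarrow},{\rightarrow^+},\tau_{com}]$ is in normal form if $$\varphi=\forall x\forall y\,\chi(x,y)\wedge\bigwedge_{i=1}^m\forall x\bigl(A_i(x)\Rightarrow\exists y(\theta_i(x,y)\wedge\chi_i(x,y))\bigr),$$ where the $A_i$ are unary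 symbols, the $\theta_i$ are order formulas, and $\chi,\chi_i$ are quantifier-free (equality is allowed). A $1$-type of $\varphi$ is a maximal satisfiable (at some node of some finite tree) set of atoms and negated atoms in the single variable $x$ over the symbols appearing in $\varphi$; let $\boldsymbol\alpha_\varphi$ be the set of these, and put $\mathfrak f(\varphi)=96\,m^3|\boldsymbol\alpha_\varphi|^3$. **Theorem.** The number $\mathfrak f(\varphi)$ is at most exponential in the size $|\varphi|$ of $\varphi$: there is a constant $c$ with $\mathfrak f(\varphi)\le 2^{c|\varphi|}$ for all normal form formulas $\varphi$. Every normal form formula $\varphi$ that is satisfied in some finite tree has a finite tree model in which every node has at most $\mathfrak f(\varphi)$ children and, provided $m\ge 1$, every ${\downarrow}$-path (sequence of nodes $v_1,\dots,v_k$ with $v_i{\downarrow}v_{i+1}$) has length, counted as its number $k$ of nodes, at most $\mathfrak f(\varphi)$. -/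

import Mathlib

open FirstOrder FirstOrder.Language

namespace TreeFO2

universe u v

/-- The navigational binary symbols: child, descendant, right sibling, following sibling. -/
inductive Nav : Type
  | child
  | desc
  | next
  | foll

/-- The relation symbols of a tree signature: unary symbols from `U`, the four navigational
binary symbols, and common (uninterpreted) binary symbols from `C`. -/
inductive TreeRel (U : Type u) (C : Type v) : ℕ → Type (max u v)
  | unary (A : U) : TreeRel U C 1
  | nav (N : Nav) : TreeRel U C 2
  | common (R : C) : TreeRel U C 2

/-- The relational first-order language of a tree signature. -/
def treeLang (U : Type u) (C : Type v) : FirstOrder.Language.{0, max u v} :=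
  ⟨fun _ => Empty, TreeRel U C⟩

section Trees

/-- `child` and `next` are the child relation and the right-sibling relation of an unranked
ordered tree (a node has arbitrarily many children, and they are linearly ordered from
left to right, `next` being the successor relation of this order). -/
structure IsOrderedTree {T : Type} (child next : T → T → Prop) : Prop where
  /-- There is a root: a node without a parent, from which every node can be reached. -/
  exists_root : ∃ r : T, (∀ p, ¬ child p r) ∧ ∀ w, Relation.ReflTransGen child r w
  /-- A node has at most one parent. -/
  parent_unique : ∀ p q w, child p w → child q w → p = q
  /-- Only nodes with a common parent are related by `next`. -/
  next_siblings : ∀ a b, next a b → ∃ p, child p a ∧ child p b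
  /-- A node has at most one right sibling. -/
  next_unique : ∀ a b c, next a b → next a c → b = c
  /-- The sibling order is irreflexive. -/
  foll_irrefl : ∀ a, ¬ Relation.TransGen next a a
  /-- The sibling order is total on the children of a node. -/
  foll_total : ∀ p a b, child p a → child p b →
    a = b ∨ Relation.TransGen next a b ∨ Relation.TransGen next b a

/-- A finite tree structure over the signature with unary symbols `U` and common binary
symbols `C`. -/
structure TreeStructure (U : Type u) (C : Type v) where
  /-- The universe of the tree. -/
  Carrier : Type
  finite : Finite Carrier
  /-- The child relation. -/
  child : Carrier → Carrier → Prop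
  /-- The right-sibling relation. -/
  next : Carrier → Carrier → Prop
  isTree : IsOrderedTree child next
  /-- The interpretation of the unary symbols. -/
  unary : U → Carrier → Prop
  /-- The interpretation of the common binary symbols. -/
  common : C → Carrier → Carrier → Prop

variable {U : Type u} {C : Type v}

/-- The interpretation of the navigational symbols in a tree. -/
def TreeStructure.nav (T : TreeStructure U C) : Nav → T.Carrier → T.Carrier → Prop
  | .child => T.child
  | .desc => Relation.TransGen T.child
  | .next => T.next
  | .foll => Relation.TransGen T.next

/-- The interpretation of all relation symbols in a tree. -/
def TreeStructure.relMap (T : TreeStructure U C) :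
    ∀ {n : ℕ}, TreeRel U C n → (Fin n → T.Carrier) → Prop
  | _, .unary A, a => T.unary A (a 0)
  | _, .nav N, a => T.nav N (a 0) (a 1)
  | _, .common R, a => T.common R (a 0) (a 1)

/-- A tree is a first-order structure over the language of its signature. -/
instance (T : TreeStructure U C) : (treeLang U C).Structure T.Carrier where
  funMap := fun f => Empty.elim f
  RelMap := fun R a => T.relMap R a

/-- The number of children of a node. -/
noncomputable def TreeStructure.degree (T : TreeStructure U C) (a : T.Carrier) : ℕ :=
  Set.ncard {b | T.child a b}

/-- A `↓`-path: a sequence of nodes in which each node is a child of its predecessor.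
Its length is the number of its nodes. -/
def TreeStructure.IsDownPath (T : TreeStructure U C) (P : List T.Carrier) : Prop :=
  P.IsChain T.child

end Trees

section Formulas

variable {U : Type u} {C : Type v}

/-- A sentence is satisfiable if it is true in some finite tree. -/
def Satisfiable (ψ : (treeLang U C).Sentence) : Prop :=
  ∃ T : TreeStructure U C, T.Carrier ⊨ ψ

/-- The relation symbols appearing in a formula. -/
def symbols {α : Type} :
    ∀ {n : ℕ}, (treeLang U C).BoundedFormula α n → Set (Σ k, TreeRel U C k)
  | _, .falsum => ∅
  | _, .equal _ _ => ∅
  | _, .rel (l := l) R _ => {⟨l, R⟩}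
  | _, .imp f g => symbols f ∪ symbols g
  | _, .all f => symbols f

/-- The size of a formula: the number of occurrences of symbols in it (relation symbols,
equality signs, variables, connectives and quantifiers). -/
def size {α : Type} : ∀ {n : ℕ}, (treeLang U C).BoundedFormula α n → ℕ
  | _, .falsum => 1
  | _, .equal _ _ => 3
  | _, .rel (l := l) _ _ => l + 1
  | _, .imp f g => size f + size g + 1
  | _, .all f => size f + 2

/-- In formulas with two variables, the variable `x` is `&0` and the variable `y` is `&1`.
`xNy N` is the atom `N(x,y)` for a navigational symbol `N`. -/
def xNy (N : Nav) : (treeLang U C).BoundedFormula Empty 2 :=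
  Relations.boundedFormula₂ (L := treeLang U C) (TreeRel.nav N) (&0) (&1)

/-- The atom `N(y,x)` for a navigational symbol `N`. -/
def yNx (N : Nav) : (treeLang U C).BoundedFormula Empty 2 :=
  Relations.boundedFormula₂ (L := treeLang U C) (TreeRel.nav N) (&1) (&0)

/-- The equality atom `x = y`. -/
def xEqy : (treeLang U C).BoundedFormula Empty 2 :=
  Term.bdEqual (&0) (&1)

/-- The ten order formulas, specifying the relative position of `x` and `y`. -/
inductive OrderFormula : Type
  | down
  | up
  | downDown
  | upUp
  | right
  | left
  | rightRight
  | leftLeft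
  | free
  | eq

/-- The formulas which the ten order formulas stand for. -/
def OrderFormula.toFormula : OrderFormula → (treeLang U C).BoundedFormula Empty 2
  | .down => xNy .child
  | .up => yNx .child
  | .downDown => xNy .desc ⊓ ∼(xNy .child)
  | .upUp => yNx .desc ⊓ ∼(yNx .child)
  | .right => xNy .next
  | .left => yNx .next
  | .rightRight => xNy .foll ⊓ ∼(xNy .next)
  | .leftLeft => yNx .foll ⊓ ∼(yNx .next)
  | .free => ∼xEqy ⊓ ∼(xNy .child) ⊓ ∼(yNx .child) ⊓ ∼(xNy .desc) ⊓ ∼(yNx .desc)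
      ⊓ ∼(xNy .next) ⊓ ∼(yNx .next) ⊓ ∼(xNy .foll) ⊓ ∼(yNx .foll)
  | .eq => xEqy

/-- The data of a `∀∃`-conjunct `∀ x (A(x) → ∃ y (θ(x,y) ∧ χ(x,y)))`, where `A` is a unary
symbol, `θ` is an order formula and `χ` is quantifier-free. -/
structure Conjunct (U : Type u) (C : Type v) where
  /-- The unary symbol `A`. -/
  guard : U
  /-- The order formula `θ`. -/
  position : OrderFormula
  /-- The formula `χ`. -/
  matrix : (treeLang U C).BoundedFormula Empty 2
  isQF : matrix.IsQF

/-- The sentence `∀ x (A(x) → ∃ y (θ(x,y) ∧ χ(x,y)))`. -/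
def Conjunct.toSentence (c : Conjunct U C) : (treeLang U C).Sentence :=
  ∀' (Relations.boundedFormula₁ (L := treeLang U C) (TreeRel.unary c.guard) (&0) ⟹
    ∃' (c.position.toFormula ⊓ c.matrix))

/-- A normal form formula
`∀ x y χ(x,y) ∧ ⋀ i, ∀ x (A_i(x) → ∃ y (θ_i(x,y) ∧ χ_i(x,y)))`. -/
structure NormalForm (U : Type u) (C : Type v) where
  /-- The formula `χ`. -/
  matrix : (treeLang U C).BoundedFormula Empty 2
  isQF : matrix.IsQF
  /-- The `∀∃`-conjuncts. -/
  conjuncts : List (Conjunct U C)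

/-- The normal form formula as a first-order sentence. -/
def NormalForm.toSentence (φ : NormalForm U C) : (treeLang U C).Sentence :=
  φ.conjuncts.foldl (fun ψ c => ψ ⊓ c.toSentence) (∀' ∀' φ.matrix)

/-- The number `m` of `∀∃`-conjuncts. -/
def NormalForm.m (φ : NormalForm U C) : ℕ := φ.conjuncts.length

/-- `Γ` is a set of atoms and negated atoms in the single free variable `x` over the
signature consisting of the symbols appearing in `ψ`. -/
def IsLiteralSet (ψ : (treeLang U C).Sentence)
    (Γ : Set ((treeLang U C).BoundedFormula Empty 1)) : Prop :=
  ∀ γ ∈ Γ, (γ.IsAtomic ∨ ∃ δ : (treeLang U C).BoundedFormula Empty 1, δ.IsAtomic ∧ γ = ∼δ) ∧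
    symbols γ ⊆ symbols ψ

/-- A set of formulas in the single free variable `x` is satisfiable if some node of some
finite tree satisfies all of them. -/
def IsSatisfiableSet (Γ : Set ((treeLang U C).BoundedFormula Empty 1)) : Prop :=
  ∃ (T : TreeStructure U C) (a : T.Carrier), ∀ γ ∈ Γ, γ.Realize Empty.elim ![a]

/-- The set `α_ψ` of (atomic) `1`-types over the signature of `ψ`: the maximal satisfiable
sets of atoms and negated atoms in the single free variable `x`. -/
def oneTypes (ψ : (treeLang U C).Sentence) :
    Set (Set ((treeLang U C).BoundedFormula Empty 1)) :=
  {Γ | Maximal (fun Δ => IsLiteralSet ψ Δ ∧ IsSatisfiableSet Δ) Γ}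

/-- The bound `f(φ) = 96 m³ |α_φ|³`. -/
noncomputable def NormalForm.bound (φ : NormalForm U C) : ℕ :=
  96 * φ.m ^ 3 * (oneTypes φ.toSentence).ncard ^ 3

end Formulas

end TreeFO2

/-!
Take a model with as few nodes as possible. For `m ≥ 1`, suppose that a `↓`-path, or the list of
the children of a node, has more than `𝔣(φ)` elements `c 1, …, c d`. Call this sequence a spine,
and give every node that belongs to the segment of `c l` the rank `l`. Seen from a node `x`, the
position of a node `b` is determined, up to exceptions close to the spine, by which of the two has
the larger rank and by whether `b` lies on the spine. Hence it suffices to keep a small repository: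
for every `1`-type, on and off the spine, `2m` nodes of highest and `2m` of lowest rank. By
pigeonhole there are spine nodes `c i`, `c j` with `i < j` of the same `1`-type such that the ranks
`i - 1, …, j` occur neither among the repository nodes, nor among their witnesses, nor among the
witnesses of these. Cut out the nodes of ranks `i, …, j - 1` and let `c j` take the place of `c i`.
A node loses at most `m` witnesses. For each of them the repository offers `2m` nodes of the same
`1`-type in the same relative position, at most `m` of which serve the node already, so new
witnesses can be chosen by Hall's theorem; the `2`-types to them are copied from the lost ones. The
choices of different nodes do not interfere, because repository nodes and their witnesses need no
new witnesses. The result is a smaller model. For `m = 0` a single node is a model.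
-/

namespace TreeFO2

open Relation

universe u v

section Relations

variable {V W : Type*} {R : V → V → Prop}

theorem transGen_of_forall_succ {c : ℕ → V} {s t : ℕ} (hst : s < t)
    (h : ∀ l, s ≤ l → l < t → R (c l) (c (l + 1))) : TransGen R (c s) (c t) :=
  (transGen_of_succ_of_lt (fun a b => R (c a) (c b)) (fun l hl => h l hl.1 hl.2) hst).lift c
    fun _ _ => id

theorem reflTransGen_total_of_leftUnique (hR : Relator.LeftUnique R) {a b x : V}
    (ha : ReflTransGen R a x) (hb : ReflTransGen R b x) :
    ReflTransGen R a b ∨ ReflTransGen R b a := by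
  rw [← reflTransGen_swap] at ha hb
  exact (ReflTransGen.total_of_right_unique hR.flip hb ha).imp reflTransGen_swap.1
    reflTransGen_swap.1

theorem transGen_onFun_iff {e : W → V} (hpred : ∀ a b, R a (e b) → a ∈ Set.range e) {a b : W} :
    TransGen (fun a b => R (e a) (e b)) a b ↔ TransGen R (e a) (e b) := by
  refine ⟨fun hab => hab.lift e fun _ _ => id, fun hab => ?_⟩
  suffices ∀ x, TransGen R x (e b) → ∀ a, e a = x → TransGen (fun a b => R (e a) (e b)) a b from
    this _ hab a rfl
  intro x hx
  induction hx using TransGen.head_induction_on with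
  | single hxb => rintro a rfl; exact .single hxb
  | head hxy hyb ih =>
    rintro a rfl
    obtain ⟨y, rfl⟩ := hyb.closed' (P := (· ∈ Set.range e))
      (by rintro p _ hp ⟨q, rfl⟩; exact hpred p q hp) ⟨b, rfl⟩
    exact .head hxy (ih y rfl)

/- The elements from `u` up to the predecessor of `v` are cut out, and `v` takes the place of `u`:
since `u ∉ K`, the transposition of `u` and `v` redirects exactly the edges into `v`. -/
theorem transGen_contract_iff [Finite V] [DecidableEq V] (hirr : ∀ a, ¬ TransGen R a a)
    (hR : Relator.LeftUnique R) {K : V → Prop} {u v : V} (huv : TransGen R u v)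
    (hpred : ∀ a (b : {x // K x}), R a (Equiv.swap u v b) → K a)
    (hcut : ∀ z, ReflTransGen R u z → TransGen R z v → ¬ K z) {a b : {x // K x}} :
    TransGen (fun a b : {x // K x} => R a (Equiv.swap u v b)) a b ↔ TransGen R a.1 b := by
  have hu : ∀ b : {x // K x}, b.1 ≠ u := fun b hb => hcut u .refl huv (hb ▸ b.2)
  constructor
  · refine fun hab => TransGen.lift' Subtype.val (fun x y hxy => ?_) _ _ hab
    by_cases hy : y.1 = v
    · rw [hy, Equiv.swap_apply_right] at hxy
      exact .head hxy (hy ▸ huv)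
    · rw [Equiv.swap_apply_of_ne_of_ne (hu y) hy] at hxy
      exact .single hxy
  · have : Std.Irrefl (TransGen R) := ⟨hirr⟩
    induction b using (Finite.wellFounded_of_trans_of_irrefl
      (InvImage (TransGen R) (Subtype.val : {x // K x} → V))).induction with
    | h b ih =>
    intro hab
    have hab' : TransGen R a (Equiv.swap u v b) ∧ ∀ x, TransGen R x (Equiv.swap u v b) →
        TransGen R x b := by
      by_cases hb : b.1 = v
      · rw [hb] at hab ⊢
        rw [Equiv.swap_apply_right]
        refine ⟨?_, fun x hx => hx.trans huv⟩
        rcases reflTransGen_total_of_leftUnique hR hab.to_reflTransGen huv.to_reflTransGen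
          with hau | hua
        · exact (reflTransGen_iff_eq_or_transGen.1 hau).resolve_left (hu a).symm
        · exact absurd a.2 (hcut a hua hab)
      · rw [Equiv.swap_apply_of_ne_of_ne (hu b) hb]
        exact ⟨hab, fun x => id⟩
    obtain ⟨p, hap, hpb⟩ := TransGen.tail'_iff.1 hab'.1
    have hp : K p := hpred p b hpb
    rcases reflTransGen_iff_eq_or_transGen.1 hap with e | hap
    · exact .single (by rwa [e] at hpb)
    · exact (ih ⟨p, hp⟩ (hab'.2 p (.single hpb)) hap).tail hpb

end Relations

namespace IsOrderedTree

variable {T : Type} {child next : T → T → Prop} {a b c p : T}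

theorem leftUnique_child (h : IsOrderedTree child next) : Relator.LeftUnique child :=
  fun p q w => h.parent_unique p q w

theorem desc_irrefl (h : IsOrderedTree child next) (a : T) : ¬ TransGen child a a := by
  obtain ⟨r, hr, hreach⟩ := h.exists_root
  induction hreach a with
  | refl =>
    intro hc
    obtain ⟨b, -, hb⟩ := TransGen.tail'_iff.1 hc
    exact hr b hb
  | @tail w x _ hwx ih =>
    intro hc
    obtain ⟨y, hxy, hyx⟩ := TransGen.tail'_iff.1 hc
    obtain rfl := h.parent_unique _ _ _ hyx hwx
    exact ih (TransGen.head' hwx hxy)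

theorem le_antisymm (h : IsOrderedTree child next) (hab : ReflTransGen child a b)
    (hba : ReflTransGen child b a) : a = b := by
  rcases reflTransGen_iff_eq_or_transGen.1 hab with e | hab
  · exact e.symm
  · exact absurd (hab.trans_left hba) (h.desc_irrefl a)

theorem le_parent (h : IsOrderedTree child next) (hab : ReflTransGen child a b)
    (hpb : child p b) (hne : b ≠ a) : ReflTransGen child a p := by
  rcases ReflTransGen.cases_tail hab with e | ⟨q, haq, hqb⟩
  · exact absurd e hne
  · rwa [h.parent_unique _ _ _ hpb hqb]

theorem le_total_of_le (h : IsOrderedTree child next) {x : T} (hax : ReflTransGen child a x)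
    (hbx : ReflTransGen child b x) : ReflTransGen child a b ∨ ReflTransGen child b a :=
  reflTransGen_total_of_leftUnique h.leftUnique_child hax hbx

theorem desc_iff_le_parent (h : IsOrderedTree child next) (hpb : child p b) :
    TransGen child a b ↔ ReflTransGen child a p := by
  rw [TransGen.tail'_iff]
  refine ⟨fun ⟨q, haq, hqb⟩ => ?_, fun hap => ⟨p, hap, hpb⟩⟩
  rwa [h.parent_unique _ _ _ hpb hqb]

theorem child_iff_of_next (h : IsOrderedTree child next) (hab : next a b) :
    child p a ↔ child p b := by
  obtain ⟨q, hqa, hqb⟩ := h.next_siblings _ _ hab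
  exact ⟨fun hp => h.parent_unique _ _ _ hp hqa ▸ hqb,
    fun hp => h.parent_unique _ _ _ hp hqb ▸ hqa⟩

theorem child_iff_of_foll (h : IsOrderedTree child next) (hab : TransGen next a b) :
    child p a ↔ child p b := by
  induction hab with
  | single hab => exact h.child_iff_of_next hab
  | tail _ hbc ih => exact ih.trans (h.child_iff_of_next hbc)

theorem exists_parent_of_foll (h : IsOrderedTree child next) (hab : TransGen next a b) :
    ∃ p, child p a ∧ child p b := by
  obtain ⟨c, hac, -⟩ := TransGen.head'_iff.1 hab
  obtain ⟨p, hpa, -⟩ := h.next_siblings _ _ hac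
  exact ⟨p, hpa, (h.child_iff_of_foll hab).1 hpa⟩

theorem not_le_of_sibling (h : IsOrderedTree child next) (hpa : child p a) (hpb : child p b)
    (hne : a ≠ b) : ¬ ReflTransGen child a b := fun hab =>
  h.desc_irrefl p (TransGen.head' hpa (h.le_parent hab hpb hne.symm))

theorem eq_of_sibling_of_le (h : IsOrderedTree child next) {x : T} (hpa : child p a)
    (hpb : child p b) (ha : ReflTransGen child a x) (hb : ReflTransGen child b x) : a = b :=
  by_contra fun hne => (h.le_total_of_le ha hb).elim (h.not_le_of_sibling hpa hpb hne)
    (h.not_le_of_sibling hpb hpa (Ne.symm hne))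

theorem not_desc_of_foll (h : IsOrderedTree child next) (hab : TransGen next a b) :
    ¬ TransGen child a b ∧ ¬ TransGen child b a := by
  obtain ⟨p, hpa, hpb⟩ := h.exists_parent_of_foll hab
  have hne : a ≠ b := by rintro rfl; exact h.foll_irrefl a hab
  exact ⟨fun hd => h.not_le_of_sibling hpa hpb hne hd.to_reflTransGen,
    fun hd => h.not_le_of_sibling hpb hpa hne.symm hd.to_reflTransGen⟩

theorem leftUnique_next (h : IsOrderedTree child next) : Relator.LeftUnique next := by
  intro a b c hac hbc
  have not_foll : ∀ a b, next a c → next b c → ¬ TransGen next a b := by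
    intro a b hac hbc hab
    obtain ⟨z, haz, hzb⟩ := TransGen.head'_iff.1 hab
    obtain rfl := h.next_unique _ _ _ hac haz
    exact h.foll_irrefl _ (TransGen.tail' hzb hbc)
  obtain ⟨p, hpa, hpc⟩ := h.next_siblings _ _ hac
  rcases h.foll_total p a b hpa ((h.child_iff_of_next hbc).2 hpc) with e | e | e
  · exact e
  · exact absurd e (not_foll _ _ hac hbc)
  · exact absurd e (not_foll _ _ hbc hac)

end IsOrderedTree

open Classical in
/-- The position of `b` relative to `a`, as one of the ten order formulas. -/
noncomputable def relPos {T : Type} (child next : T → T → Prop) (a b : T) : OrderFormula :=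
  if a = b then .eq
  else if child a b then .down
  else if child b a then .up
  else if TransGen child a b then .downDown
  else if TransGen child b a then .upUp
  else if next a b then .right
  else if next b a then .left
  else if TransGen next a b then .rightRight
  else if TransGen next b a then .leftLeft
  else .free

/-- The order formula `θ(y, x)`, where `θ` is the given order formula. -/
def OrderFormula.flip : OrderFormula → OrderFormula
  | .down => .up
  | .up => .down
  | .downDown => .upUp
  | .upUp => .downDown
  | .right => .left
  | .left => .right
  | .rightRight => .leftLeft
  | .leftLeft => .rightRight
  | .free => .free
  | .eq => .eq

/-- Two pairs of nodes, possibly of different trees, satisfy the same navigational atoms of the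
form `N(x, y)` or `x = y`. -/
structure NavAgree {T T' : Type} (child next : T → T → Prop) (child' next' : T' → T' → Prop)
    (a b : T) (a' b' : T') : Prop where
  eq_iff : a = b ↔ a' = b'
  child_iff : child a b ↔ child' a' b'
  desc_iff : TransGen child a b ↔ TransGen child' a' b'
  next_iff : next a b ↔ next' a' b'
  foll_iff : TransGen next a b ↔ TransGen next' a' b'

theorem relPos_congr {T T' : Type} {child next : T → T → Prop} {child' next' : T' → T' → Prop}
    {a b : T} {a' b' : T'} (h : NavAgree child next child' next' a b a' b')
    (h' : NavAgree child next child' next' b a b' a') :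
    relPos child next a b = relPos child' next' a' b' := by
  classical
  simp only [relPos, h.eq_iff, h.child_iff, h.desc_iff, h.next_iff, h.foll_iff, h'.child_iff,
    h'.desc_iff, h'.next_iff, h'.foll_iff]

/-- The semantics of the order formulas in an ordered tree. -/
def OrderFormula.Holds {T : Type} (child next : T → T → Prop) (a b : T) : OrderFormula → Prop
  | .down => child a b
  | .up => child b a
  | .downDown => TransGen child a b ∧ ¬ child a b
  | .upUp => TransGen child b a ∧ ¬ child b a
  | .right => next a b
  | .left => next b a
  | .rightRight => TransGen next a b ∧ ¬ next a b
  | .leftLeft => TransGen next b a ∧ ¬ next b a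
  | .free => a ≠ b ∧ ¬ child a b ∧ ¬ child b a ∧ ¬ TransGen child a b ∧ ¬ TransGen child b a ∧
      ¬ next a b ∧ ¬ next b a ∧ ¬ TransGen next a b ∧ ¬ TransGen next b a
  | .eq => a = b

section RelPos

variable {T : Type} {child next : T → T → Prop}

theorem relPos_self (a : T) : relPos child next a a = .eq := if_pos rfl

theorem holds_relPos (a b : T) : (relPos child next a b).Holds child next a b := by
  classical
  unfold relPos
  split_ifs <;> simp_all [OrderFormula.Holds]

theorem OrderFormula.Holds.unique (h : IsOrderedTree child next) {a b : T} {θ θ' : OrderFormula}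
    (hθ : θ.Holds child next a b) (hθ' : θ'.Holds child next a b) : θ = θ' := by
  have child_desc : ∀ a b, child a b → TransGen child a b := fun _ _ => .single
  have next_foll : ∀ a b, next a b → TransGen next a b := fun _ _ => .single
  have desc_asymm : ∀ a b, TransGen child a b → ¬ TransGen child b a :=
    fun a b hab hba => h.desc_irrefl a (hab.trans hba)
  have foll_asymm : ∀ a b, TransGen next a b → ¬ TransGen next b a :=
    fun a b hab hba => h.foll_irrefl a (hab.trans hba)
  have not_desc := fun a b => h.not_desc_of_foll (a := a) (b := b)
  cases θ <;> cases θ' <;> simp only [OrderFormula.Holds] at hθ hθ' ⊢ <;> grind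

end RelPos

namespace IsOrderedTree

variable {T T' : Type} {child next : T → T → Prop} {child' next' : T' → T' → Prop}

theorem relPos_eq_iff (h : IsOrderedTree child next) {a b : T} {θ : OrderFormula} :
    relPos child next a b = θ ↔ θ.Holds child next a b :=
  ⟨fun e => e ▸ holds_relPos a b, (holds_relPos a b).unique h⟩

theorem relPos_flip (h : IsOrderedTree child next) (a b : T) :
    relPos child next b a = (relPos child next a b).flip := by
  rw [h.relPos_eq_iff]
  have := holds_relPos (child := child) (next := next) a b
  revert this
  cases relPos child next a b <;> simp only [OrderFormula.Holds, OrderFormula.flip] <;>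
    first | exact id | exact Eq.symm | tauto

theorem navAgree_of_relPos_eq (h : IsOrderedTree child next) (h' : IsOrderedTree child' next')
    {a b : T} {a' b' : T'} (e : relPos child next a b = relPos child' next' a' b') :
    NavAgree child next child' next' a b a' b' := by
  have holds_iff : ∀ θ : OrderFormula, θ.Holds child next a b ↔ θ.Holds child' next' a' b' := by
    intro θ; rw [← h.relPos_eq_iff, ← h'.relPos_eq_iff, e]
  have transGen_iff : ∀ {R : T → T → Prop} {R' : T' → T' → Prop}, (R a b ↔ R' a' b') →
      (TransGen R a b ∧ ¬ R a b ↔ TransGen R' a' b' ∧ ¬ R' a' b') →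
      (TransGen R a b ↔ TransGen R' a' b') := by
    intro R R' hR hTR
    have := TransGen.single (r := R) (a := a) (b := b)
    have := TransGen.single (r := R') (a := a') (b := b')
    tauto
  exact ⟨holds_iff .eq, holds_iff .down, transGen_iff (holds_iff .down) (holds_iff .downDown),
    holds_iff .right, transGen_iff (holds_iff .right) (holds_iff .rightRight)⟩

open Classical in
theorem relPos_of_subtree (h : IsOrderedTree child next) {x z b : T}
    (hx : ¬ ReflTransGen child z x) (hb : ReflTransGen child z b) (hne : b ≠ z) :
    relPos child next x b = if TransGen child x z then .downDown else .free := by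
  obtain ⟨p, hzp, hpb⟩ := (ReflTransGen.cases_tail hb).resolve_left hne
  have hchild : ¬ child x b := fun hc => hx (h.parent_unique _ _ _ hpb hc ▸ hzp)
  split_ifs with hd <;> rw [h.relPos_eq_iff]
  · exact ⟨hd.trans_left hb, hchild⟩
  · have hxb : ¬ ReflTransGen child x b := fun hc =>
      (h.le_total_of_le hc hb).elim
        (fun hxz => (reflTransGen_iff_eq_or_transGen.1 hxz).elim (fun e => hx (e ▸ .refl)) hd) hx
    have hbx : ¬ ReflTransGen child b x := fun hc => hx (hb.trans hc)
    have hpx : ¬ child p x := fun hc => hx (hzp.tail hc)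
    have hf : ¬ TransGen next x b := fun hc => hpx ((h.child_iff_of_foll hc).2 hpb)
    have hf' : ¬ TransGen next b x := fun hc => hpx ((h.child_iff_of_foll hc).1 hpb)
    exact ⟨fun e => hbx (e ▸ .refl), hchild, fun hc => hbx (.single hc),
      fun hc => hxb hc.to_reflTransGen, fun hc => hbx hc.to_reflTransGen,
      fun hc => hf (.single hc), fun hc => hf' (.single hc), hf, hf'⟩

end IsOrderedTree

section Formulas

variable {U : Type u} {C : Type v}

theorem term_eq_var {n : ℕ} (t : (treeLang U C).Term (Empty ⊕ Fin n)) :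
    ∃ i, t = Term.var (Sum.inr i) := by
  rcases t with (e | i) | ⟨f, ts⟩
  · exact e.elim
  · exact ⟨i, rfl⟩
  · exact Empty.elim f

theorem realize_congr {T T' : TreeStructure U C} {n : ℕ}
    {ψ : (treeLang U C).BoundedFormula Empty n} (h : ψ.IsQF) {e : Empty → T.Carrier}
    {e' : Empty → T'.Carrier} {xs : Fin n → T.Carrier} {xs' : Fin n → T'.Carrier}
    (heq : ∀ i j, xs i = xs j ↔ xs' i = xs' j)
    (hrel : ∀ s ∈ symbols ψ, ∀ σ : Fin s.1 → Fin n,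
      T.relMap s.2 (fun i => xs (σ i)) ↔ T'.relMap s.2 (fun i => xs' (σ i))) :
    ψ.Realize e xs ↔ ψ.Realize e' xs' := by
  induction h with
  | falsum => exact Iff.rfl
  | @of_isAtomic γ hγ =>
    rcases hγ with ⟨t₁, t₂⟩ | ⟨R, ts⟩
    · obtain ⟨i, rfl⟩ := term_eq_var t₁
      obtain ⟨j, rfl⟩ := term_eq_var t₂
      simpa using heq i j
    · choose σ hσ using fun i => term_eq_var (ts i)
      obtain rfl : ts = fun i => Term.var (Sum.inr (σ i)) := funext hσ
      exact hrel ⟨_, R⟩ rfl σ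
  | imp _ _ ih₁ ih₂ =>
    rw [BoundedFormula.realize_imp, BoundedFormula.realize_imp,
      ih₁ fun s hs => hrel s (Or.inl hs), ih₂ fun s hs => hrel s (Or.inr hs)]

/-- The literals, i.e. atoms and negated atoms, in the variable `x` over the symbols of `ψ`. -/
def IsLiteral (ψ : (treeLang U C).Sentence) (γ : (treeLang U C).BoundedFormula Empty 1) : Prop :=
  (γ.IsAtomic ∨ ∃ δ : (treeLang U C).BoundedFormula Empty 1, δ.IsAtomic ∧ γ = ∼δ) ∧
    symbols γ ⊆ symbols ψ

/-- The `1`-type over the symbols of `ψ` which is realized by the node `a`. -/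
def nodeType (ψ : (treeLang U C).Sentence) (T : TreeStructure U C) (a : T.Carrier) :
    Set ((treeLang U C).BoundedFormula Empty 1) :=
  {γ | IsLiteral ψ γ ∧ γ.Realize Empty.elim ![a]}

/-- The atom with symbol `s` whose arguments are all `x`. -/
def loopAtom (s : Σ k, TreeRel U C k) : (treeLang U C).BoundedFormula Empty 1 :=
  BoundedFormula.rel (L := treeLang U C) s.2 fun _ => &0

section NodeType

variable {ψ : (treeLang U C).Sentence} {T T' : TreeStructure U C} {a : T.Carrier} {a' : T'.Carrier}

theorem loopAtom_mem_nodeType {s : Σ k, TreeRel U C k} (hs : s ∈ symbols ψ) :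
    loopAtom s ∈ nodeType ψ T a ↔ T.relMap s.2 (fun _ => a) :=
  ⟨fun h => h.2, fun h => ⟨⟨Or.inl (.rel _ _), Set.singleton_subset_iff.2 hs⟩, h⟩⟩

theorem nodeType_eq_iff : nodeType ψ T a = nodeType ψ T' a' ↔
    ∀ s ∈ symbols ψ, T.relMap s.2 (fun _ => a) ↔ T'.relMap s.2 (fun _ => a') := by
  refine ⟨fun h s hs => by rw [← loopAtom_mem_nodeType hs, h, loopAtom_mem_nodeType hs],
    fun h => Set.ext fun γ => and_congr_right fun hγ => ?_⟩
  refine realize_congr ?_ (fun i j => by simp [Subsingleton.elim i j]) fun s hs σ => ?_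
  · rcases hγ.1 with h | ⟨δ, hδ, rfl⟩
    · exact h.isQF
    · exact hδ.isQF.not
  · obtain rfl : σ = fun _ => 0 := Subsingleton.elim _ _
    exact h s (hγ.2 hs)

theorem symbols_not {n : ℕ} (γ : (treeLang U C).BoundedFormula Empty n) :
    symbols (∼γ) = symbols γ :=
  Set.union_empty _

theorem symbols_inf {n : ℕ} (γ δ : (treeLang U C).BoundedFormula Empty n) :
    symbols (γ ⊓ δ) = symbols γ ∪ symbols δ := by
  change symbols (∼(γ.imp (∼δ))) = _
  rw [symbols_not, symbols, symbols_not]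

theorem nodeType_mem_oneTypes (ψ : (treeLang U C).Sentence) (T : TreeStructure U C)
    (a : T.Carrier) : nodeType ψ T a ∈ oneTypes ψ := by
  refine ⟨⟨fun γ hγ => hγ.1, T, a, fun γ hγ => hγ.2⟩, ?_⟩
  rintro Δ ⟨hΔ, _, _, hsat⟩ hle γ hγ
  refine ⟨hΔ γ hγ, ?_⟩
  by_contra hn
  rcases hΔ γ hγ with ⟨hat | ⟨δ, hδ, rfl⟩, hs⟩
  · have : ∼γ ∈ nodeType ψ T a :=
      ⟨⟨Or.inr ⟨γ, hat, rfl⟩, (symbols_not γ).trans_subset hs⟩, hn⟩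
    exact hsat _ (hle this) (hsat _ hγ)
  · rw [symbols_not] at hs
    rw [BoundedFormula.realize_not, not_not] at hn
    exact hsat _ hγ (hsat _ (hle ⟨⟨Or.inl hδ, hs⟩, hn⟩))

theorem exists_nodeType_eq {Γ : Set ((treeLang U C).BoundedFormula Empty 1)}
    (hΓ : Γ ∈ oneTypes ψ) : ∃ (T : TreeStructure U C) (a : T.Carrier), nodeType ψ T a = Γ := by
  obtain ⟨⟨hΓl, T, a, hsat⟩, hmax⟩ := hΓ
  have hle : Γ ⊆ nodeType ψ T a := fun γ hγ => ⟨hΓl γ hγ, hsat γ hγ⟩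
  exact ⟨T, a, (hmax (nodeType_mem_oneTypes ψ T a).1 hle).antisymm hle⟩

end NodeType

section Size

variable {α : Type} {n : ℕ}

theorem symbols_finite (ψ : (treeLang U C).BoundedFormula α n) : (symbols ψ).Finite := by
  induction ψ with
  | falsum => exact Set.finite_empty
  | equal => exact Set.finite_empty
  | rel => exact Set.finite_singleton _
  | imp _ _ ih₁ ih₂ => exact ih₁.union ih₂
  | all _ ih => exact ih

theorem ncard_symbols_le (ψ : (treeLang U C).BoundedFormula α n) :
    (symbols ψ).ncard ≤ size ψ := by
  induction ψ with
  | falsum => simp [symbols]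
  | equal => simp [symbols]
  | rel R ts => simp [symbols, size]
  | imp f g ih₁ ih₂ =>
    have := Set.ncard_union_le (symbols f) (symbols g)
    simp only [symbols, size]
    omega
  | all f ih => exact ih.trans (Nat.le_add_right _ 2)

theorem injOn_loopSymbols (ψ : (treeLang U C).Sentence) :
    Set.InjOn (fun Γ => {s ∈ symbols ψ | loopAtom s ∈ Γ}) (oneTypes ψ) := by
  intro Γ hΓ Γ' hΓ' he
  obtain ⟨T, a, rfl⟩ := exists_nodeType_eq hΓ
  obtain ⟨T', a', rfl⟩ := exists_nodeType_eq hΓ'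
  refine nodeType_eq_iff.2 fun s hs => ?_
  rw [← loopAtom_mem_nodeType hs, ← loopAtom_mem_nodeType hs]
  simpa [hs] using Set.ext_iff.1 he s

theorem mapsTo_loopSymbols (ψ : (treeLang U C).Sentence) :
    Set.MapsTo (fun Γ => {s ∈ symbols ψ | loopAtom s ∈ Γ}) (oneTypes ψ) (𝒫 (symbols ψ)) :=
  fun _ _ => Set.sep_subset _ _

theorem oneTypes_finite (ψ : (treeLang U C).Sentence) : (oneTypes ψ).Finite :=
  .of_injOn (mapsTo_loopSymbols ψ) (injOn_loopSymbols ψ) (symbols_finite ψ).powerset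

theorem ncard_oneTypes_le (ψ : (treeLang U C).Sentence) : (oneTypes ψ).ncard ≤ 2 ^ size ψ :=
  calc (oneTypes ψ).ncard ≤ (𝒫 (symbols ψ)).ncard :=
        Set.ncard_le_ncard_of_injOn _ (mapsTo_loopSymbols ψ) (injOn_loopSymbols ψ)
          (symbols_finite ψ).powerset
    _ = 2 ^ (symbols ψ).ncard := Set.ncard_powerset _ (symbols_finite ψ)
    _ ≤ 2 ^ size ψ := Nat.pow_le_pow_right two_pos (ncard_symbols_le ψ)

theorem length_add_size_le (l : List (Conjunct U C)) (ψ : (treeLang U C).Sentence) :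
    l.length + size ψ ≤ size (l.foldl (fun ψ c => ψ ⊓ c.toSentence) ψ) := by
  induction l generalizing ψ with
  | nil => simp
  | cons c l ih =>
    have hinf : size (ψ ⊓ c.toSentence) = (size ψ + (size c.toSentence + 1 + 1) + 1) + 1 + 1 := rfl
    have := ih (ψ ⊓ c.toSentence)
    simp only [List.length_cons, List.foldl_cons]
    omega

theorem NormalForm.m_lt_size (φ : NormalForm U C) : φ.m < size φ.toSentence := by
  have hlen : φ.m + (size φ.matrix + 2 + 2) ≤ size φ.toSentence :=
    length_add_size_le φ.conjuncts (∀' ∀' φ.matrix)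
  omega

theorem NormalForm.bound_le (φ : NormalForm U C) : φ.bound ≤ 2 ^ (13 * size φ.toSentence) := by
  have hsize := φ.m_lt_size
  have hm : φ.m ≤ 2 ^ size φ.toSentence := hsize.le.trans Nat.lt_two_pow_self.le
  have hn := ncard_oneTypes_le φ.toSentence
  calc φ.bound = 96 * φ.m ^ 3 * (oneTypes φ.toSentence).ncard ^ 3 := rfl
    _ ≤ 2 ^ 7 * (2 ^ size φ.toSentence) ^ 3 * (2 ^ size φ.toSentence) ^ 3 := by gcongr; norm_num
    _ = 2 ^ (7 + 6 * size φ.toSentence) := by ring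
    _ ≤ 2 ^ (13 * size φ.toSentence) := Nat.pow_le_pow_right two_pos (by omega)

end Size

section Symbols

theorem symbols_foldl_inf (l : List (Conjunct U C)) (ψ : (treeLang U C).Sentence) :
    symbols (l.foldl (fun ψ c => ψ ⊓ c.toSentence) ψ) =
      symbols ψ ∪ ⋃ c ∈ l, symbols c.toSentence := by
  induction l generalizing ψ with
  | nil => simp
  | cons c l ih => simp [ih, symbols_inf, Set.iUnion_or, Set.iUnion_union_distrib, Set.union_assoc]

theorem NormalForm.symbols_toSentence (φ : NormalForm U C) :
    symbols φ.toSentence = symbols φ.matrix ∪ ⋃ c ∈ φ.conjuncts, symbols c.toSentence :=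
  symbols_foldl_inf _ _

theorem NormalForm.symbols_matrix_subset (φ : NormalForm U C) :
    symbols φ.matrix ⊆ symbols φ.toSentence :=
  φ.symbols_toSentence ▸ Set.subset_union_left

theorem Conjunct.symbols_toSentence (c : Conjunct U C) :
    symbols c.toSentence = {⟨1, .unary c.guard⟩} ∪
      (symbols (c.position.toFormula (U := U) (C := C)) ∪ symbols c.matrix) := by
  rw [← symbols_inf]
  exact congrArg _ ((Set.union_empty _).trans (Set.union_empty _))

theorem NormalForm.symbols_conjunct_subset (φ : NormalForm U C) {c : Conjunct U C}
    (hc : c ∈ φ.conjuncts) : symbols c.toSentence ⊆ symbols φ.toSentence := by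
  rw [φ.symbols_toSentence]
  exact (Set.subset_biUnion_of_mem (u := fun c : Conjunct U C => symbols c.toSentence) hc).trans
    Set.subset_union_right

theorem NormalForm.symbols_conjunct_matrix_subset (φ : NormalForm U C) {c : Conjunct U C}
    (hc : c ∈ φ.conjuncts) : symbols c.matrix ⊆ symbols φ.toSentence := by
  refine Set.Subset.trans ?_ (φ.symbols_conjunct_subset hc)
  rw [c.symbols_toSentence]
  exact Set.subset_union_right.trans Set.subset_union_right

theorem NormalForm.guard_mem_symbols (φ : NormalForm U C) {c : Conjunct U C}
    (hc : c ∈ φ.conjuncts) : ⟨1, .unary c.guard⟩ ∈ symbols φ.toSentence := by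
  refine φ.symbols_conjunct_subset hc ?_
  rw [c.symbols_toSentence]
  exact Or.inl rfl

theorem NormalForm.guard_iff_of_nodeType_eq (φ : NormalForm U C) {c : Conjunct U C}
    (hc : c ∈ φ.conjuncts) {T T' : TreeStructure U C} {a : T.Carrier} {a' : T'.Carrier}
    (h : nodeType φ.toSentence T a = nodeType φ.toSentence T' a') :
    T.unary c.guard a ↔ T'.unary c.guard a' :=
  nodeType_eq_iff.1 h _ (φ.guard_mem_symbols hc)

end Symbols

section Realize

theorem realize_toFormula (T : TreeStructure U C) (θ : OrderFormula) (e : Empty → T.Carrier)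
    (a b : T.Carrier) : (θ.toFormula (U := U) (C := C)).Realize e ![a, b] ↔
      θ.Holds T.child T.next a b := by
  have realize_xNy : ∀ N, (xNy (U := U) (C := C) N).Realize e ![a, b] ↔ T.nav N a b :=
    fun _ => Iff.rfl
  have realize_yNx : ∀ N, (yNx (U := U) (C := C) N).Realize e ![a, b] ↔ T.nav N b a :=
    fun _ => Iff.rfl
  cases θ <;>
    simp [OrderFormula.toFormula, realize_xNy, realize_yNx, xEqy, OrderFormula.Holds,
      TreeStructure.nav, and_assoc]

theorem snoc_snoc {M : Type*} (x y : M) :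
    (Fin.snoc (Fin.snoc (default : Fin 0 → M) x : Fin 1 → M) y : Fin 2 → M) = ![x, y] := by
  funext i
  fin_cases i <;> rfl

/-- The node `b` is a witness of the conjunct `c` for the node `a`. -/
def Conjunct.IsWitness (c : Conjunct U C) (T : TreeStructure U C) (a b : T.Carrier) : Prop :=
  relPos T.child T.next a b = c.position ∧ c.matrix.Realize (default : Empty → T.Carrier) ![a, b]

theorem Conjunct.realize_toSentence (T : TreeStructure U C) (c : Conjunct U C) :
    Sentence.Realize T.Carrier c.toSentence ↔
      ∀ a, T.unary c.guard a → ∃ b, c.IsWitness T a b := by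
  simp only [Sentence.Realize, Formula.Realize, Conjunct.toSentence, BoundedFormula.realize_all,
    BoundedFormula.realize_imp, BoundedFormula.realize_ex, BoundedFormula.realize_inf, snoc_snoc,
    realize_toFormula, Conjunct.IsWitness, T.isTree.relPos_eq_iff]
  exact Iff.rfl

theorem realize_foldl_inf (T : TreeStructure U C) (l : List (Conjunct U C))
    (ψ : (treeLang U C).Sentence) :
    Sentence.Realize T.Carrier (l.foldl (fun ψ c => ψ ⊓ c.toSentence) ψ) ↔
      Sentence.Realize T.Carrier ψ ∧ ∀ c ∈ l, Sentence.Realize T.Carrier c.toSentence := by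
  induction l generalizing ψ with
  | nil => simp
  | cons c l ih =>
    rw [List.foldl_cons, ih]
    simp only [Sentence.Realize, Formula.Realize, BoundedFormula.realize_inf, List.mem_cons,
      forall_eq_or_imp, and_assoc]

theorem NormalForm.realize_toSentence (T : TreeStructure U C) (φ : NormalForm U C) :
    Sentence.Realize T.Carrier φ.toSentence ↔
      (∀ a b, φ.matrix.Realize (default : Empty → T.Carrier) ![a, b]) ∧
      ∀ c ∈ φ.conjuncts, ∀ a, T.unary c.guard a → ∃ b, c.IsWitness T a b := by
  rw [NormalForm.toSentence, realize_foldl_inf]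
  simp only [Conjunct.realize_toSentence]
  simp only [Sentence.Realize, Formula.Realize, BoundedFormula.realize_all, snoc_snoc]

end Realize

section TwoTypes

variable {ψ : (treeLang U C).Sentence} {T T' : TreeStructure U C}

/-- The pairs of nodes `(a, b)` and `(a', b')` have the same `2`-type over the symbols of `ψ`.
Common symbols not occurring in `ψ` are, for simplicity, required to agree as well. -/
structure SameTwoType (ψ : (treeLang U C).Sentence) (T T' : TreeStructure U C)
    (a b : T.Carrier) (a' b' : T'.Carrier) : Prop where
  relPos_eq : relPos T.child T.next a b = relPos T'.child T'.next a' b'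
  nodeType_fst : nodeType ψ T a = nodeType ψ T' a'
  nodeType_snd : nodeType ψ T b = nodeType ψ T' b'
  common_iff : ∀ R, T.common R a b ↔ T'.common R a' b'
  common_swap_iff : ∀ R, T.common R b a ↔ T'.common R b' a'

theorem nav_iff_of_relPos_eq {a b : T.Carrier} {a' b' : T'.Carrier}
    (h : relPos T.child T.next a b = relPos T'.child T'.next a' b') (N : Nav) :
    T.nav N a b ↔ T'.nav N a' b' := by
  have := T.isTree.navAgree_of_relPos_eq T'.isTree h
  cases N
  · exact this.child_iff
  · exact this.desc_iff
  · exact this.next_iff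
  · exact this.foll_iff

namespace SameTwoType

variable {a b : T.Carrier} {a' b' : T'.Carrier}

theorem relMap_iff (h : SameTwoType ψ T T' a b a' b') {s : Σ k, TreeRel U C k}
    (hs : s ∈ symbols ψ) (σ : Fin s.1 → Fin 2) :
    T.relMap s.2 (fun i => ![a, b] (σ i)) ↔ T'.relMap s.2 (fun i => ![a', b'] (σ i)) := by
  have diag_left := nodeType_eq_iff.1 h.nodeType_fst s hs
  have diag_right := nodeType_eq_iff.1 h.nodeType_snd s hs
  obtain ⟨_, A | N | R⟩ := s
  · change T.unary A (![a, b] (σ 0)) ↔ T'.unary A (![a', b'] (σ 0))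
    generalize σ 0 = i
    fin_cases i
    exacts [diag_left, diag_right]
  · have hswap : relPos T.child T.next b a = relPos T'.child T'.next b' a' := by
      rw [T.isTree.relPos_flip a b, T'.isTree.relPos_flip a' b', h.relPos_eq]
    change T.nav N (![a, b] (σ 0)) (![a, b] (σ 1)) ↔ T'.nav N (![a', b'] (σ 0)) (![a', b'] (σ 1))
    generalize σ 0 = i, σ 1 = j
    fin_cases i <;> fin_cases j
    exacts [diag_left, nav_iff_of_relPos_eq h.relPos_eq N, nav_iff_of_relPos_eq hswap N, diag_right]
  · change T.common R (![a, b] (σ 0)) (![a, b] (σ 1)) ↔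
      T'.common R (![a', b'] (σ 0)) (![a', b'] (σ 1))
    generalize σ 0 = i, σ 1 = j
    fin_cases i <;> fin_cases j
    exacts [diag_left, h.common_iff R, h.common_swap_iff R, diag_right]

theorem realize_iff (h : SameTwoType ψ T T' a b a' b')
    {χ : (treeLang U C).BoundedFormula Empty 2} (hχ : χ.IsQF) (hs : symbols χ ⊆ symbols ψ) :
    χ.Realize (default : Empty → T.Carrier) ![a, b] ↔
      χ.Realize (default : Empty → T'.Carrier) ![a', b'] := by
  refine realize_congr hχ (fun i j => ?_) fun s hsχ σ => h.relMap_iff (hs hsχ) σ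
  have heq : a = b ↔ a' = b' := (T.isTree.navAgree_of_relPos_eq T'.isTree h.relPos_eq).eq_iff
  fin_cases i <;> fin_cases j <;> simp [heq, eq_comm (a := b), eq_comm (a := b')]

theorem isWitness_iff {φ : NormalForm U C} (h : SameTwoType φ.toSentence T T' a b a' b')
    {c : Conjunct U C} (hc : c ∈ φ.conjuncts) : c.IsWitness T a b ↔ c.IsWitness T' a' b' := by
  unfold Conjunct.IsWitness
  rw [h.relPos_eq, h.realize_iff c.isQF (φ.symbols_conjunct_matrix_subset hc)]

end SameTwoType

end TwoTypes

section Pullback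

variable {V : Type} {child next : V → V → Prop}

/-- A prescription of types for the ordered tree with relations `child` and `next` in terms of
another tree `T`: the node `x` is to have the `1`-type of `e x`, and the pair `(x, y)` is to have
the `2`-type of the pair `π x y`. -/
structure IsTypeAssignment (ψ : (treeLang U C).Sentence) (T : TreeStructure U C)
    (child next : V → V → Prop) (e : V → T.Carrier) (π : V → V → T.Carrier × T.Carrier) :
    Prop where
  swap : ∀ x y, π y x = (π x y).swap
  self : ∀ x, π x x = (e x, e x)
  nodeType_fst : ∀ x y, nodeType ψ T (π x y).1 = nodeType ψ T (e x)
  relPos_eq : ∀ x y, relPos T.child T.next (π x y).1 (π x y).2 = relPos child next x y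

/-- The tree structure on an ordered tree which realizes a type assignment. -/
def TreeStructure.pullback [Finite V] (T : TreeStructure U C) (hV : IsOrderedTree child next)
    (e : V → T.Carrier) (π : V → V → T.Carrier × T.Carrier) : TreeStructure U C where
  Carrier := V
  finite := inferInstance
  child := child
  next := next
  isTree := hV
  unary A x := T.unary A (e x)
  common R x y := T.common R (π x y).1 (π x y).2

namespace IsTypeAssignment

variable [Finite V] {T : TreeStructure U C} {hV : IsOrderedTree child next} {e : V → T.Carrier}
  {π : V → V → T.Carrier × T.Carrier}

theorem nodeType_pullback {ψ : (treeLang U C).Sentence} (h : IsTypeAssignment ψ T child next e π)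
    (x : V) : nodeType ψ (T.pullback hV e π) x = nodeType ψ T (e x) := by
  refine nodeType_eq_iff.2 ?_
  rintro ⟨_, A | N | R⟩ -
  · exact Iff.rfl
  · exact nav_iff_of_relPos_eq (T := T.pullback hV e π)
      ((relPos_self (T := V) x).trans (relPos_self (e x)).symm) N
  · change T.common R (π x x).1 (π x x).2 ↔ T.common R (e x) (e x)
    rw [h.self]

theorem sameTwoType {ψ : (treeLang U C).Sentence} (h : IsTypeAssignment ψ T child next e π)
    (x y : V) : SameTwoType ψ (T.pullback hV e π) T x y (π x y).1 (π x y).2 where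
  relPos_eq := (h.relPos_eq x y).symm
  nodeType_fst := (h.nodeType_pullback x).trans (h.nodeType_fst x y).symm
  nodeType_snd := (h.nodeType_pullback y).trans <| by rw [← h.nodeType_fst y x, h.swap x y]; rfl
  common_iff _ := Iff.rfl
  common_swap_iff R := by
    change T.common R (π y x).1 (π y x).2 ↔ _
    rw [h.swap x y]
    rfl

theorem realize_pullback {φ : NormalForm U C} (hT : Sentence.Realize T.Carrier φ.toSentence)
    (h : IsTypeAssignment φ.toSentence T child next e π)
    (hwit : ∀ c ∈ φ.conjuncts, ∀ x, T.unary c.guard (e x) →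
      ∃ y, c.IsWitness T (π x y).1 (π x y).2) :
    Sentence.Realize (T.pullback hV e π).Carrier φ.toSentence := by
  rw [NormalForm.realize_toSentence] at hT
  refine (φ.realize_toSentence (T.pullback hV e π)).2 ⟨fun x y => ?_, fun c hc x hx => ?_⟩
  · exact ((h.sameTwoType x y).realize_iff φ.isQF φ.symbols_matrix_subset).2 (hT.1 _ _)
  · obtain ⟨y, hy⟩ := hwit c hc x hx
    exact ⟨y, ((h.sameTwoType x y).isWitness_iff hc).2 hy⟩

end IsTypeAssignment

end Pullback

end Formulas

section Choice

variable {V σ τ : Type*}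

theorem exists_subset_card_le_forall_le {α : Type*} [LinearOrder α] (r : V → α) (B : Finset V)
    (s : ℕ) : ∃ F ⊆ B, F.card ≤ s ∧ ∀ b ∈ B, b ∉ F → F.card = s ∧ ∀ f ∈ F, r b ≤ r f := by
  classical
  induction s with
  | zero => exact ⟨∅, by simp, by simp, by simp⟩
  | succ s ih =>
    obtain ⟨F, hFB, hF, h⟩ := ih
    rcases (B \ F).eq_empty_or_nonempty with he | hne
    · exact ⟨F, hFB, by omega,
        fun b hb hbF => absurd (Finset.sdiff_eq_empty_iff_subset.1 he hb) hbF⟩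
    · obtain ⟨a, ha, hmax⟩ := Finset.exists_max_image (B \ F) r hne
      obtain ⟨haB, haF⟩ := Finset.mem_sdiff.1 ha
      have hcard : (insert a F).card = s + 1 := by
        rw [Finset.card_insert_of_notMem haF, (h a haB haF).1]
      refine ⟨insert a F, Finset.insert_subset haB hFB, hcard.le, fun b hb hbF => ⟨hcard, ?_⟩⟩
      rw [Finset.mem_insert, not_or] at hbF
      exact (Finset.forall_mem_insert ..).2
        ⟨hmax b (Finset.mem_sdiff.2 ⟨hb, hbF.2⟩), (h b hb hbF.2).2⟩

theorem exists_option_choice (D W : Finset V) (C : V → Finset V) {n : ℕ}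
    (hn : D.card + W.card ≤ n) (hC : ∀ b ∈ D, n ≤ (C b).card) :
    ∃ f : V → Option V, (∀ y b, f y = some b → b ∈ D ∧ y ∈ C b ∧ y ∉ W) ∧
      ∀ b ∈ D, ∃ y, f y = some b := by
  classical
  obtain ⟨g, g_inj, hg⟩ : ∃ g : D → V, Function.Injective g ∧ ∀ b : D, g b ∈ C b \ W := by
    refine (Finset.all_card_le_biUnion_card_iff_exists_injective fun b : D => C b \ W).1 fun S => ?_
    rcases S.eq_empty_or_nonempty with rfl | ⟨b, hb⟩
    · simp
    · have hS : S.card ≤ D.card := by simpa using S.card_le_univ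
      have hCb := hC b b.2
      have hsdiff := Finset.le_card_sdiff W (C b)
      have hunion := Finset.card_le_card
        (Finset.subset_biUnion_of_mem (fun b : D => C b \ W) hb)
      omega
  refine ⟨fun y => (Function.partialInv g y).map Subtype.val, fun y b hy => ?_, fun b hb => ?_⟩
  · obtain ⟨b, hb, rfl⟩ := Option.map_eq_some_iff.1 hy
    rw [g_inj.isPartialInv] at hb
    subst hb
    exact ⟨b.2, Finset.mem_sdiff.1 (hg b)⟩
  · refine ⟨g ⟨b, hb⟩, ?_⟩
    simp only [Function.partialInv_left g_inj, Option.map_some]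

/-- A set `F` of elements of positive rank such that for any further such element `b` there are `s`
elements of `F` of the same type with ranks at least that of `b`, and `s` with ranks at most that
of `b`. -/
structure IsRepository (tp : V → σ) (rank : V → ℕ) (s : ℕ) (F : Finset V) : Prop where
  rank_pos : ∀ f ∈ F, 1 ≤ rank f
  exists_high : ∀ b ∉ F, 1 ≤ rank b →
    ∃ G ⊆ F, G.card = s ∧ ∀ f ∈ G, tp f = tp b ∧ rank b ≤ rank f
  exists_low : ∀ b ∉ F, 1 ≤ rank b →
    ∃ G ⊆ F, G.card = s ∧ ∀ f ∈ G, tp f = tp b ∧ rank f ≤ rank b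

theorem exists_isRepository [Finite V] [Fintype σ] (tp : V → σ) (rank : V → ℕ) (s : ℕ) :
    ∃ F, IsRepository tp rank s F ∧ F.card ≤ 2 * s * Fintype.card σ := by
  classical
  have := Fintype.ofFinite V
  let B (t : σ) : Finset V := {b | 1 ≤ rank b ∧ tp b = t}
  have mem_B (b : V) (hb : 1 ≤ rank b) : b ∈ B (tp b) := by simpa [B] using hb
  choose H hHB hHs hH using fun t => exists_subset_card_le_forall_le rank (B t) s
  choose L hLB hLs hL using fun t =>
    exists_subset_card_le_forall_le (OrderDual.toDual ∘ rank) (B t) s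
  let F : Finset V := Finset.univ.biUnion fun t => H t ∪ L t
  have hHF (t : σ) : H t ⊆ F := Finset.subset_union_left.trans
    (Finset.subset_biUnion_of_mem (fun t => H t ∪ L t) (Finset.mem_univ t))
  have hLF (t : σ) : L t ⊆ F := Finset.subset_union_right.trans
    (Finset.subset_biUnion_of_mem (fun t => H t ∪ L t) (Finset.mem_univ t))
  refine ⟨F, ⟨fun f hf => ?_, fun b hbF hb => ?_, fun b hbF hb => ?_⟩, ?_⟩
  · obtain ⟨t, -, ht⟩ := Finset.mem_biUnion.1 hf
    exact (Finset.mem_filter.1 (Finset.union_subset (hHB t) (hLB t) ht)).2.1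
  · obtain ⟨hcard, hle⟩ := hH _ b (mem_B b hb) fun h => hbF (hHF _ h)
    exact ⟨_, hHF _, hcard, fun f hf => ⟨(Finset.mem_filter.1 (hHB _ hf)).2.2, hle f hf⟩⟩
  · obtain ⟨hcard, hle⟩ := hL _ b (mem_B b hb) fun h => hbF (hLF _ h)
    exact ⟨_, hLF _, hcard, fun f hf => ⟨(Finset.mem_filter.1 (hLB _ hf)).2.2, hle f hf⟩⟩
  · calc F.card ≤ Fintype.card σ * (2 * s) := Finset.card_biUnion_le_card_mul _ _ _ fun t _ =>
          (Finset.card_union_le _ _).trans (by have := hHs t; have := hLs t; omega)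
      _ = 2 * s * Fintype.card σ := Nat.mul_comm _ _

-- The ranks `2, …, d` are cut into blocks of length `card τ + 2`; a block avoiding `R` contains
-- more than `card τ` indices whose predecessors lie in the block as well.
theorem exists_equal_types [Fintype τ] (t : ℕ → τ) (R : Finset ℕ) (d : ℕ)
    (hd : (R.card + 1) * (Fintype.card τ + 2) ≤ d) :
    ∃ i j, 2 ≤ i ∧ i < j ∧ j ≤ d ∧ t i = t j ∧ ∀ r ∈ R, r + 1 < i ∨ j < r := by
  set n := Fintype.card τ
  obtain ⟨q, hq, hqR⟩ : ∃ q ∈ Finset.range (R.card + 1),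
      q ∉ R.image (fun r => (r - 1) / (n + 2)) :=
    Finset.exists_mem_notMem_of_card_lt_card <| by
      simpa [Nat.lt_succ_iff] using Finset.card_image_le
  have hq' : (q + 1) * (n + 2) ≤ d :=
    (Nat.mul_le_mul_right _ (Finset.mem_range.1 hq)).trans hd
  obtain ⟨a, b, hab, htab⟩ : ∃ a b : Fin (n + 1), a < b ∧
      t (q * (n + 2) + 2 + a) = t (q * (n + 2) + 2 + b) := by
    obtain ⟨a, b, hne, he⟩ := Fintype.exists_ne_map_eq_of_card_lt
      (fun a : Fin (n + 1) => t (q * (n + 2) + 2 + a)) (by simp [n])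
    rcases hne.lt_or_gt with h | h
    exacts [⟨a, b, h, he⟩, ⟨b, a, h, he.symm⟩]
  have hexp : (q + 1) * (n + 2) = q * (n + 2) + n + 2 := by ring
  refine ⟨_, _, by omega, by omega, by omega, htab, fun r hr => ?_⟩
  by_contra! hcon
  refine hqR (Finset.mem_image.2 ⟨r, hr, ?_⟩)
  rw [Nat.div_eq_iff (by omega)]
  omega

end Choice

section Redirect

variable {V τ P : Type*} {m : ℕ}

/-- The nodes of ranks `i - 1, …, j`: those whose relations to other nodes are affected when the
nodes of ranks `i, …, j - 1` are removed. -/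
def window (rank : V → ℕ) (i j : ℕ) : Set V :=
  {x | i ≤ rank x + 1 ∧ rank x ≤ j}

open Classical in
/-- The nodes chosen by one of the functions `w k` for a node of `S`. -/
noncomputable def witnesses (w : Fin m → V → V) (S : Finset V) : Finset V :=
  S.biUnion fun x => Finset.univ.image fun k => w k x

theorem card_witnesses_le (w : Fin m → V → V) (S : Finset V) :
    (witnesses w S).card ≤ S.card * m := by
  classical
  refine Finset.card_biUnion_le_card_mul _ _ _ fun x _ => ?_
  exact Finset.card_image_le.trans (by simp)

theorem mem_witnesses (w : Fin m → V → V) {S : Finset V} {x : V} (hx : x ∈ S) (k : Fin m) :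
    w k x ∈ witnesses w S := by
  classical
  exact Finset.mem_biUnion.2 ⟨x, hx, Finset.mem_image_of_mem _ (Finset.mem_univ _)⟩

open Classical in
/-- The elements of `F` that can replace `b` as a witness of `x`. -/
noncomputable def candidates (pos : V → V → P) (tp : V → τ) (F : Finset V) (x b : V) : Finset V :=
  {y ∈ F | tp y = tp b ∧ pos x y = pos x b}

theorem mem_candidates {pos : V → V → P} {tp : V → τ} {F : Finset V} {x b y : V} :
    y ∈ candidates pos tp F x b ↔ y ∈ F ∧ tp y = tp b ∧ pos x y = pos x b := by
  classical
  exact Finset.mem_filter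

/-- A partial choice of new witnesses: if `f x y = some b`, then `y` replaces the witness `b` of
`x`, which lies in the set `N`. -/
structure IsRedirection (pos : V → V → P) (tp : V → τ) (w : Fin m → V → V) (F : Finset V)
    (N : Set V) (f : V → V → Option V) : Prop where
  candidate : ∀ {x y b}, f x y = some b → y ∈ candidates pos tp F x b
  exists_witness : ∀ {x y b}, f x y = some b → ∃ k, w k x ∈ N
  ne_witness : ∀ {x y b}, f x y = some b → ∀ k, w k x ≠ y
  exists_eq_some : ∀ x k, w k x ∈ N → 2 * m ≤ (candidates pos tp F x (w k x)).card →
    ∃ y, f x y = some (w k x)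

theorem exists_isRedirection (pos : V → V → P) (tp : V → τ) (w : Fin m → V → V) (F : Finset V)
    (N : Set V) : ∃ f, IsRedirection pos tp w F N f := by
  classical
  let W (x : V) : Finset V := Finset.univ.image fun k => w k x
  let D (x : V) : Finset V := {b ∈ W x | b ∈ N ∧ 2 * m ≤ (candidates pos tp F x b).card}
  have card_W (x : V) : (W x).card ≤ m := Finset.card_image_le.trans (by simp)
  have card_D (x : V) : (D x).card + (W x).card ≤ 2 * m := by
    have : (D x).card ≤ m := (Finset.card_filter_le _ _).trans (card_W x)
    have := card_W x
    omega
  have mem_W (x : V) (k : Fin m) : w k x ∈ W x := Finset.mem_image_of_mem _ (Finset.mem_univ k)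
  choose f hf hfD using fun x => exists_option_choice (D x) (W x) (candidates pos tp F x)
    (card_D x) fun b hb => (Finset.mem_filter.1 hb).2.2
  refine ⟨f, fun h => (hf _ _ _ h).2.1, fun {x y b} h => ?_, fun {x y b} h k e => ?_,
    fun x k hN hC => hfD x _ (Finset.mem_filter.2 ⟨mem_W x k, hN, hC⟩)⟩
  · obtain ⟨hbW, hbN, -⟩ := Finset.mem_filter.1 (hf x y b h).1
    obtain ⟨k, -, rfl⟩ := Finset.mem_image.1 hbW
    exact ⟨k, hbN⟩
  · exact (hf x y b h).2.2 (e ▸ mem_W x k)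

/-- The assignment `base` of pairs to pairs, modified so that `(x, y)` is sent to `(x, b)` and
`(y, x)` to `(b, x)` whenever `f x y = some b`. -/
def redirect (base : V → V → V × V) (f : V → V → Option V) (x y : V) : V × V :=
  match f x y, f y x with
  | some b, _ => (x, b)
  | none, some a => (a, y)
  | none, none => base x y

variable {base : V → V → V × V} {f : V → V → Option V} {x y b : V}

theorem redirect_of_eq_some (h : f x y = some b) : redirect base f x y = (x, b) := by
  rw [redirect, h]

theorem redirect_of_eq_some_swap (h : f x y = none) (h' : f y x = some b) :
    redirect base f x y = (b, y) := by
  rw [redirect, h, h']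

theorem redirect_of_eq_none (h : f x y = none) (h' : f y x = none) :
    redirect base f x y = base x y := by
  rw [redirect, h, h']

open Classical in
/-- The pair of nodes to which `(x, y)` corresponds when `v` takes the place of `u` with respect to
the nodes of rank `i - 1`. -/
noncomputable def basePair (rank : V → ℕ) (i : ℕ) (u v x y : V) : V × V :=
  if rank x + 1 = i ∧ y = v then (x, u) else if rank y + 1 = i ∧ x = v then (u, y) else (x, y)

theorem basePair_swap {rank : V → ℕ} {i : ℕ} {u v : V} (hv : rank v + 1 ≠ i) (x y : V) :
    basePair rank i u v y x = (basePair rank i u v x y).swap := by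
  simp only [basePair]
  by_cases h : rank x + 1 = i ∧ y = v
  · have h' : ¬ (rank y + 1 = i ∧ x = v) := fun h' => hv (h.2 ▸ h'.1)
    rw [if_neg h', if_pos h, if_pos h]
    rfl
  · rw [if_neg h, if_neg h]
    split_ifs <;> rfl

theorem basePair_of_not {rank : V → ℕ} {i : ℕ} {u v : V} (hxy : ¬ (rank x + 1 = i ∧ y = v))
    (hyx : ¬ (rank y + 1 = i ∧ x = v)) : basePair rank i u v x y = (x, y) := by
  rw [basePair, if_neg hxy, if_neg hyx]

/-- An assignment of pairs of nodes to pairs of nodes, to be realized after removing the nodes of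
ranks `i, …, j - 1` and putting `c j` in the place of `c i`: it respects the types of single nodes
and the relative positions, and provides a node that is not removed with witnesses among the nodes
that are not removed. -/
structure IsRerouting (pos : V → V → P) (tp : V → τ) (w : Fin m → V → V) (c : ℕ → V)
    (rank : V → ℕ) (i j : ℕ) (π : V → V → V × V) : Prop where
  swap : ∀ x y, π y x = (π x y).swap
  self : ∀ x, π x x = (x, x)
  type_fst : ∀ x y, tp (π x y).1 = tp x
  pos_eq : ∀ x y, pos (π x y).1 (π x y).2 =
    pos (basePair rank i (c i) (c j) x y).1 (basePair rank i (c i) (c j) x y).2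
  exists_witness : ∀ x, ¬ (i ≤ rank x ∧ rank x < j) → ∀ k, ∃ y, ¬ (i ≤ rank y ∧ rank y < j) ∧
    (π x y = (x, w k x) ∨ x = c j ∧ π x y = (c i, w k (c i)))

namespace IsRedirection

variable {pos : V → V → P} {tp : V → τ} {w : Fin m → V → V} {F : Finset V} {rank : V → ℕ}
  {c : ℕ → V} {i j : ℕ} {N : Set V}

theorem eq_none_of_forall_notMem (h : IsRedirection pos tp w F N f) (hx : ∀ k, w k x ∉ N) :
    f x y = none := by
  refine Option.eq_none_iff_forall_ne_some.2 fun b hb => ?_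
  obtain ⟨k, hk⟩ := h.exists_witness hb
  exact hx k hk

theorem mem (h : IsRedirection pos tp w F N f) (hf : f x y = some b) : y ∈ F :=
  (mem_candidates.1 (h.candidate hf)).1

theorem eq_none_of_notMem (h : IsRedirection pos tp w F N f) (hy : y ∉ F) : f x y = none :=
  Option.eq_none_iff_forall_ne_some.2 fun _ hb => hy (h.mem hb)

theorem asymm (h : IsRedirection pos tp w F N f) (hF : ∀ x ∈ F, ∀ k, w k x ∉ N)
    (hf : f x y = some b) : f y x = none :=
  h.eq_none_of_forall_notMem (hF y (h.mem hf))

theorem redirect_swap (h : IsRedirection pos tp w F N f) (hF : ∀ x ∈ F, ∀ k, w k x ∉ N)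
    (hbase : base y x = (base x y).swap) :
    redirect base f y x = (redirect base f x y).swap := by
  rcases hxy : f x y with _ | b
  · rcases hyx : f y x with _ | a
    · rw [redirect_of_eq_none hxy hyx, redirect_of_eq_none hyx hxy, hbase]
    · rw [redirect_of_eq_some hyx, redirect_of_eq_some_swap hxy hyx, Prod.swap]
  · rw [redirect_of_eq_some hxy, redirect_of_eq_some_swap (h.asymm hF hxy) hxy, Prod.swap]

theorem redirect_self (h : IsRedirection pos tp w F N f) (hF : ∀ x ∈ F, ∀ k, w k x ∉ N) :
    redirect base f x x = base x x := by
  have hxx : f x x = none := Option.eq_none_iff_forall_ne_some.2 fun b hb =>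
    Option.some_ne_none b (hb.symm.trans (h.asymm hF hb))
  exact redirect_of_eq_none hxx hxx

theorem redirect_witness (h : IsRedirection pos tp w F N f)
    (hF : ∀ x ∈ F, ∀ k l, w l (w k x) ∉ N) {k : Fin m} (hbase : base x (w k x) = (x, w k x)) :
    redirect base f x (w k x) = (x, w k x) := by
  rw [redirect_of_eq_none _ _, hbase]
  · exact Option.eq_none_iff_forall_ne_some.2 fun _ hb => h.ne_witness hb k rfl
  · exact Option.eq_none_iff_forall_ne_some.2 fun _ hb =>
      (h.exists_witness hb).elim (hF x (h.mem hb) k)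

theorem type_redirect_fst (h : IsRedirection pos tp w F N f)
    (hbase : tp (base x y).1 = tp x) : tp (redirect base f x y).1 = tp x := by
  rcases hxy : f x y with _ | b
  · rcases hyx : f y x with _ | a
    · rwa [redirect_of_eq_none hxy hyx]
    · rw [redirect_of_eq_some_swap hxy hyx, (mem_candidates.1 (h.candidate hyx)).2.1]
  · rw [redirect_of_eq_some hxy]

theorem pos_redirect (h : IsRedirection pos tp w F N f) {flip : P → P}
    (hflip : ∀ x y, pos y x = flip (pos x y))
    (hbase : ∀ x, ∀ y ∈ F, base x y = (x, y) ∧ base y x = (y, x)) :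
    pos (redirect base f x y).1 (redirect base f x y).2 = pos (base x y).1 (base x y).2 := by
  rcases hxy : f x y with _ | b
  · rcases hyx : f y x with _ | a
    · rw [redirect_of_eq_none hxy hyx]
    · rw [redirect_of_eq_some_swap hxy hyx, (hbase y x (h.mem hyx)).2, hflip y a, hflip y x,
        (mem_candidates.1 (h.candidate hyx)).2.2]
  · rw [redirect_of_eq_some hxy, (hbase x y (h.mem hxy)).1,
      (mem_candidates.1 (h.candidate hxy)).2.2]

end IsRedirection

theorem basePair_of_notMem_window {rank : V → ℕ} {i j : ℕ} {u v : V} (hv : rank v = j)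
    (hij : i < j) (hy : y ∉ window rank i j) :
    basePair rank i u v x y = (x, y) ∧ basePair rank i u v y x = (y, x) := by
  have hy' : ¬ (i ≤ rank y + 1 ∧ rank y ≤ j) := hy
  have hyv : y ≠ v := by
    rintro rfl
    omega
  have hyi : rank y + 1 ≠ i := by omega
  exact ⟨basePair_of_not (fun h => hyv h.2) fun h => hyi h.1,
    basePair_of_not (fun h => hyi h.1) fun h => hyv h.2⟩

theorem type_basePair_fst {tp : V → τ} {rank : V → ℕ} {i : ℕ} {u v : V} (huv : tp u = tp v) :
    tp (basePair rank i u v x y).1 = tp x := by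
  unfold basePair
  split_ifs with _ h
  exacts [rfl, h.2 ▸ huv, rfl]

theorem card_image_witnesses_mul_le (w : Fin m → V → V) (rank : V → ℕ) [DecidableEq V]
    {F : Finset V} {n d : ℕ} (hm : 1 ≤ m) (hn : 1 ≤ n) (hF : F.card ≤ 8 * m * n)
    (hd : 96 * m ^ 3 * n ^ 3 ≤ d) :
    (((F ∪ witnesses w F ∪ witnesses w (witnesses w F)).image rank).card + 1) * (n + 2) ≤ d := by
  set W := witnesses w F
  have hW : W.card ≤ F.card * m := card_witnesses_le w F
  have hpow : 1 ≤ m ^ 3 * n := Nat.mul_pos (pow_pos hm 3) hn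
  have hcard : ((F ∪ W ∪ witnesses w W).image rank).card ≤ 24 * (m ^ 3 * n) :=
    calc ((F ∪ W ∪ witnesses w W).image rank).card
      _ ≤ F.card + W.card + (witnesses w W).card :=
          Finset.card_image_le.trans <| (Finset.card_union_le _ _).trans <|
            Nat.add_le_add_right (Finset.card_union_le _ _) _
      _ ≤ F.card + F.card * m + F.card * m * m := by
          gcongr
          exact (card_witnesses_le w W).trans (Nat.mul_le_mul_right _ hW)
      _ ≤ F.card * (m * m) + F.card * (m * m) + F.card * (m * m) := by
          have := Nat.le_mul_of_pos_right F.card (Nat.mul_pos hm hm)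
          have := Nat.mul_le_mul_left F.card (Nat.le_mul_of_pos_right m hm)
          have := mul_assoc F.card m m
          omega
      _ ≤ 8 * m * n * (m * m) + 8 * m * n * (m * m) + 8 * m * n * (m * m) := by gcongr
      _ = 24 * (m ^ 3 * n) := by ring
  calc (((F ∪ W ∪ witnesses w W).image rank).card + 1) * (n + 2)
    _ ≤ 25 * (m ^ 3 * n) * (3 * n) := Nat.mul_le_mul (by omega) (by omega)
    _ = 75 * m ^ 3 * n ^ 2 := by ring
    _ ≤ 96 * m ^ 3 * n ^ 3 := by
        gcongr
        exacts [by norm_num, by norm_num]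
    _ ≤ d := hd

end Redirect

section Spine

variable {V τ P : Type*} {m : ℕ}

/-- A sequence of nodes `c 1, …, c d`, such as a path or the children of a node, together with a
function `rank` which assigns `l` to the nodes belonging to the segment of `c l` and `0` to the
nodes outside all segments. Up to exceptions close to the spine, the position `pos x b` of `b`
relative to `x` depends only on the order of the ranks and on whether `b` lies on the spine. -/
structure IsSpine (pos : V → V → P) (d : ℕ) (c : ℕ → V) (rank : V → ℕ) : Prop where
  rank_spine : ∀ l, 1 ≤ l → l ≤ d → rank (c l) = l
  pos_above : ∀ x b f, rank x < rank b → rank x < rank f → b ≠ c (rank x + 1) →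
    f ≠ c (rank x + 1) → (b = c (rank b) ↔ f = c (rank f)) → pos x b = pos x f
  pos_below : ∀ y b f, 1 ≤ rank b → 1 ≤ rank f → rank b < rank y → rank f < rank y →
    (y = c (rank y) → rank b + 1 < rank y ∧ rank f + 1 < rank y) →
    (b = c (rank b) ↔ f = c (rank f)) → pos y b = pos y f
  pos_adjacent : ∀ i j b, 2 ≤ i → i < j → j ≤ d → rank b + 1 = j →
    (∀ f, 1 ≤ rank f → rank f + 1 < j → (b = c (rank b) ↔ f = c (rank f)) →
      pos (c j) b = pos (c j) f) ∨
    ∀ b', pos (c i) b' = pos (c j) b → rank b' + 1 = i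

/-- The type of a node refined by whether the node lies on the spine. -/
def spineType (tp : V → τ) (c : ℕ → V) (rank : V → ℕ) (x : V) : τ × Prop :=
  (tp x, x = c (rank x))

namespace IsRepository

variable {pos : V → V → P} {tp : V → τ} {c : ℕ → V} {rank : V → ℕ} {s i j : ℕ} {F : Finset V}
  {x b : V}

theorem le_card_candidates_of_high (hF : IsRepository (spineType tp c rank) rank s F)
    (hFN : ∀ f ∈ F, f ∉ window rank i j) (hb : b ∈ window rank i j) (hi : 2 ≤ i)
    (hpos : ∀ f ∈ F, (b = c (rank b) ↔ f = c (rank f)) → j < rank f → pos x f = pos x b) :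
    s ≤ (candidates pos tp F x b).card := by
  have hib : i ≤ rank b + 1 := hb.1
  obtain ⟨G, hGF, rfl, hG⟩ := hF.exists_high b (fun h => hFN b h hb) (by omega)
  refine Finset.card_le_card fun f hf => mem_candidates.2 ?_
  obtain ⟨htype, hrank⟩ := hG f hf
  obtain ⟨htp, hspine⟩ := Prod.ext_iff.1 htype
  have hfN : ¬ (i ≤ rank f + 1 ∧ rank f ≤ j) := hFN f (hGF hf)
  exact ⟨hGF hf, htp, hpos f (hGF hf) (Iff.of_eq hspine.symm) (by omega)⟩

theorem le_card_candidates_of_low (hF : IsRepository (spineType tp c rank) rank s F)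
    (hFN : ∀ f ∈ F, f ∉ window rank i j) (hb : b ∈ window rank i j) (hi : 2 ≤ i)
    (hpos : ∀ f ∈ F, (b = c (rank b) ↔ f = c (rank f)) → rank f + 1 < i → pos x f = pos x b) :
    s ≤ (candidates pos tp F x b).card := by
  have ⟨hib, hbj⟩ : i ≤ rank b + 1 ∧ rank b ≤ j := hb
  obtain ⟨G, hGF, rfl, hG⟩ := hF.exists_low b (fun h => hFN b h hb) (by omega)
  refine Finset.card_le_card fun f hf => mem_candidates.2 ?_
  obtain ⟨htype, hrank⟩ := hG f hf
  obtain ⟨htp, hspine⟩ := Prod.ext_iff.1 htype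
  have hfN : ¬ (i ≤ rank f + 1 ∧ rank f ≤ j) := hFN f (hGF hf)
  exact ⟨hGF hf, htp, hpos f (hGF hf) (Iff.of_eq hspine.symm) (by omega)⟩

end IsRepository

namespace IsSpine

variable {pos : V → V → P} {d : ℕ} {c : ℕ → V} {rank : V → ℕ} {tp : V → τ} {s i j : ℕ}
  {F : Finset V} {x : V}

theorem pos_eq_of_rank_lt (hs : IsSpine pos d c rank) (hx : rank x + 1 < i) (hij : i < j)
    (hjd : j ≤ d) : pos x (c i) = pos x (c j) := by
  have hri := hs.rank_spine i (by omega) (by omega)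
  have hrj := hs.rank_spine j (by omega) hjd
  have hrx := hs.rank_spine (rank x + 1) (by omega) (by omega)
  refine hs.pos_above x _ _ (by omega) (by omega) (fun e => ?_) (fun e => ?_)
    (by rw [hri, hrj]; exact iff_of_true rfl rfl)
  · rw [e] at hri
    omega
  · rw [e] at hrj
    omega

theorem cases_of_rank_lt (hs : IsSpine pos d c rank)
    (hF : IsRepository (spineType tp c rank) rank s F) (hFN : ∀ f ∈ F, f ∉ window rank i j)
    (hi : 2 ≤ i) (hij : i < j) (hjd : j ≤ d) (hx : rank x < i) (b : V) :
    (¬ (i ≤ rank b ∧ rank b < j) ∧ basePair rank i (c i) (c j) x b = (x, b)) ∨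
      (rank x + 1 = i ∧ b = c i) ∨
      b ∈ window rank i j ∧ s ≤ (candidates pos tp F x b).card := by
  have rank_cj : rank (c j) = j := hs.rank_spine j (by omega) hjd
  have rank_succ : rank (c (rank x + 1)) = rank x + 1 := hs.rank_spine _ (by omega) (by omega)
  by_cases hbij : i ≤ rank b ∧ rank b ≤ j
  · by_cases hbx : b = c (rank x + 1)
    · have hxi : rank x + 1 = i := by
        rw [hbx, rank_succ] at hbij
        omega
      exact Or.inr (Or.inl ⟨hxi, hxi ▸ hbx⟩)
    · have hbN : b ∈ window rank i j := ⟨by omega, hbij.2⟩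
      refine Or.inr (Or.inr ⟨hbN, hF.le_card_candidates_of_high hFN hbN hi fun f _ hk hfj => ?_⟩)
      refine hs.pos_above x f b (by omega) (by omega) (fun hfx => ?_) hbx hk.symm
      rw [hfx, rank_succ] at hfj
      omega
  · refine Or.inl ⟨by omega, basePair_of_not ?_ ?_⟩
    · rintro ⟨-, rfl⟩
      omega
    · rintro ⟨-, rfl⟩
      omega

theorem cases_of_le_rank (hs : IsSpine pos d c rank)
    (hF : IsRepository (spineType tp c rank) rank s F) (hFN : ∀ f ∈ F, f ∉ window rank i j)
    (hi : 2 ≤ i) (hij : i < j) (hjd : j ≤ d) (hx : j ≤ rank x) (b : V) :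
    (¬ (i ≤ rank b ∧ rank b < j) ∧ basePair rank i (c i) (c j) x b = (x, b)) ∨
      (x = c j ∧ ∀ b', pos (c i) b' = pos x b → rank b' + 1 = i) ∨
      b ∈ window rank i j ∧ s ≤ (candidates pos tp F x b).card := by
  have rank_cj : rank (c j) = j := hs.rank_spine j (by omega) hjd
  by_cases hbij : i ≤ rank b + 1 ∧ rank b < j
  · have hbN : b ∈ window rank i j := ⟨hbij.1, hbij.2.le⟩
    have key (h : ∀ f ∈ F, (b = c (rank b) ↔ f = c (rank f)) → rank f + 1 < i →
        pos x f = pos x b) := hF.le_card_candidates_of_low hFN hbN hi h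
    by_cases hadj : x = c j ∧ rank b + 1 = j
    · obtain ⟨rfl, hbj⟩ := hadj
      rcases hs.pos_adjacent i j b hi hij hjd hbj with h | h
      · exact Or.inr <| Or.inr ⟨hbN, key fun f hf hk hfi =>
          (h f (hF.rank_pos f hf) (by omega) hk).symm⟩
      · exact Or.inr (Or.inl ⟨rfl, h⟩)
    · refine Or.inr (Or.inr ⟨hbN, key fun f hf hk hfi => ?_⟩)
      refine hs.pos_below x f b (hF.rank_pos f hf) (by omega) (by omega) (by omega)
        (fun hxc => ?_) hk.symm
      have : rank x ≠ j ∨ rank b + 1 ≠ j := by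
        by_contra! h
        exact hadj ⟨h.1 ▸ hxc, h.2⟩
      omega
  · exact Or.inl ⟨by omega, basePair_of_not (by omega) (by omega)⟩

theorem isRerouting (hs : IsSpine pos d c rank) {w : Fin m → V → V} {flip : P → P}
    (hflip : ∀ x y, pos y x = flip (pos x y))
    (hw : ∀ k a b, tp a = tp b → pos a (w k a) = pos b (w k b))
    (hF : IsRepository (spineType tp c rank) rank (2 * m) F) (hFN : ∀ x ∈ F, x ∉ window rank i j)
    (hFN₁ : ∀ x ∈ F, ∀ k, w k x ∉ window rank i j)
    (hFN₂ : ∀ x ∈ F, ∀ k l, w l (w k x) ∉ window rank i j)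
    (hi : 2 ≤ i) (hij : i < j) (hjd : j ≤ d) (htp : tp (c i) = tp (c j)) {f : V → V → Option V}
    (hf : IsRedirection pos tp w F (window rank i j) f) :
    IsRerouting pos tp w c rank i j (redirect (basePair rank i (c i) (c j)) f) := by
  have rank_ci : rank (c i) = i := hs.rank_spine i (by omega) (by omega)
  have rank_cj : rank (c j) = j := hs.rank_spine j (by omega) hjd
  have redirect_window {x y : V} (hx : x ∈ window rank i j) (hy : y ∈ window rank i j) :
      redirect (basePair rank i (c i) (c j)) f x y = basePair rank i (c i) (c j) x y :=
    redirect_of_eq_none (hf.eq_none_of_notMem fun h => hFN y h hy)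
      (hf.eq_none_of_notMem fun h => hFN x h hx)
  refine ⟨fun x y => hf.redirect_swap hFN₁ (basePair_swap (by omega) x y), fun x => ?_,
    fun x y => hf.type_redirect_fst (type_basePair_fst htp), fun x y => hf.pos_redirect hflip
      fun x y hy => basePair_of_notMem_window rank_cj hij (hFN y hy), fun x hx k => ?_⟩
  · rw [hf.redirect_self hFN₁, basePair_of_not] <;>
    · rintro ⟨h, rfl⟩
      omega
  have displaced (hN : w k x ∈ window rank i j)
      (hcard : 2 * m ≤ (candidates pos tp F x (w k x)).card) :
      ∃ y, ¬ (i ≤ rank y ∧ rank y < j) ∧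
        redirect (basePair rank i (c i) (c j)) f x y = (x, w k x) := by
    obtain ⟨y, hy⟩ := hf.exists_eq_some x k hN hcard
    have hyN : ¬ (i ≤ rank y + 1 ∧ rank y ≤ j) := hFN y (hf.mem hy)
    exact ⟨y, by omega, redirect_of_eq_some hy⟩
  rcases lt_or_ge (rank x) i with hxi | hxi
  · rcases hs.cases_of_rank_lt hF hFN hi hij hjd hxi (w k x) with ⟨h, hbase⟩ | ⟨h, hk⟩ | ⟨hN, hcard⟩
    · exact ⟨_, h, Or.inl (hf.redirect_witness hFN₂ hbase)⟩
    · refine ⟨c j, by omega, Or.inl ?_⟩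
      rw [redirect_window ⟨h.ge, by omega⟩ ⟨by omega, rank_cj.le⟩, hk, basePair, if_pos ⟨h, rfl⟩]
    · exact (displaced hN hcard).imp fun y hy => ⟨hy.1, Or.inl hy.2⟩
  · have hjx : j ≤ rank x := by omega
    rcases hs.cases_of_le_rank hF hFN hi hij hjd hjx (w k x) with
      ⟨h, hbase⟩ | ⟨rfl, h⟩ | ⟨hN, hcard⟩
    · exact ⟨_, h, Or.inl (hf.redirect_witness hFN₂ hbase)⟩
    · have hk : rank (w k (c i)) + 1 = i := h _ (hw k _ _ htp)
      refine ⟨w k (c i), by omega, Or.inr ⟨rfl, ?_⟩⟩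
      have hj : ¬ (rank (c j) + 1 = i ∧ w k (c i) = c j) := by omega
      rw [redirect_window ⟨by omega, rank_cj.le⟩ ⟨hk.ge, by omega⟩, basePair, if_neg hj,
        if_pos ⟨hk, rfl⟩]
    · exact (displaced hN hcard).imp fun y hy => ⟨hy.1, Or.inl hy.2⟩

theorem exists_isRerouting [Finite V] [Fintype τ] (hs : IsSpine pos d c rank) (tp : V → τ)
    (w : Fin m → V → V) {flip : P → P} (hflip : ∀ x y, pos y x = flip (pos x y))
    (hw : ∀ k a b, tp a = tp b → pos a (w k a) = pos b (w k b)) (hm : 1 ≤ m)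
    (hd : 96 * m ^ 3 * Fintype.card τ ^ 3 ≤ d) :
    ∃ i j π, 2 ≤ i ∧ i < j ∧ j ≤ d ∧ tp (c i) = tp (c j) ∧
      IsRerouting pos tp w c rank i j π := by
  classical
  obtain ⟨F, hF, hFcard⟩ := exists_isRepository (spineType tp c rank) rank (2 * m)
  have hτ : 1 ≤ Fintype.card τ := Fintype.card_pos_iff.2 ⟨tp (c 0)⟩
  have hFcard' : F.card ≤ 8 * m * Fintype.card τ := by
    rw [Fintype.card_prod, Fintype.card_prop] at hFcard
    exact hFcard.trans (by ring_nf; rfl)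
  set Q := F ∪ witnesses w F ∪ witnesses w (witnesses w F)
  obtain ⟨i, j, hi, hij, hjd, htp, hR⟩ := exists_equal_types (fun l => tp (c l)) (Q.image rank) d
    (card_image_witnesses_mul_le w rank hm hτ hFcard' hd)
  have hQN (q : V) (hq : q ∈ Q) : q ∉ window rank i j := by
    rintro ⟨h, h'⟩
    have := hR _ (Finset.mem_image_of_mem rank hq)
    omega
  obtain ⟨f, hf⟩ := exists_isRedirection pos tp w F (window rank i j)
  refine ⟨i, j, _, hi, hij, hjd, htp, hs.isRerouting hflip hw hF (fun x hx => hQN x ?_)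
    (fun x hx k => hQN _ ?_) (fun x hx k l => hQN _ ?_) hi hij hjd htp hf⟩
  · exact Finset.mem_union_left _ (Finset.mem_union_left _ hx)
  · exact Finset.mem_union_left _ (Finset.mem_union_right _ (mem_witnesses w hx k))
  · exact Finset.mem_union_right _ (mem_witnesses w (mem_witnesses w hx k) l)

end IsSpine

end Spine

section Contraction

variable {T : Type} {child next : T → T → Prop}

theorem IsOrderedTree.relPos_of_desc (h : IsOrderedTree child next) {a b : T}
    (hab : TransGen child a b) [Decidable (child a b)] :
    relPos child next a b = if child a b then .down else .downDown := by
  split_ifs with hc <;> rw [h.relPos_eq_iff]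
  exacts [hc, ⟨hab, hc⟩]

theorem IsOrderedTree.of_embedding {W : Type} (h : IsOrderedTree child next) {e σ : W → T}
    {next' : W → W → Prop} (he : e.Injective) (hσ : σ.Injective)
    (hroot : ∀ r, (∀ p, ¬ child p r) → ∃ w, e w = r ∧ σ w = r)
    (hpred : ∀ a b, child a (σ b) → a ∈ Set.range e)
    (hdesc : ∀ a b, TransGen child (e a) (e b) → TransGen (fun a b => child (e a) (σ b)) a b)
    (hnext : ∀ a b c, next' a b → next' a c → b = c)
    (hfoll : ∀ a b, TransGen next' a b ↔ TransGen next (σ a) (σ b)) :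
    IsOrderedTree (fun a b => child (e a) (σ b)) next' where
  exists_root := by
    obtain ⟨r, hr, hreach⟩ := h.exists_root
    obtain ⟨w, hw, hσw⟩ := hroot r hr
    refine ⟨w, fun p hp => hr _ (hσw ▸ hp), fun x => ?_⟩
    rcases reflTransGen_iff_eq_or_transGen.1 (hreach (e x)) with hx | hx
    · rw [he (hx.trans hw.symm)]
    · exact (hdesc w x (hw ▸ hx)).to_reflTransGen
  parent_unique p q w hp hq := he (h.parent_unique _ _ _ hp hq)
  next_siblings a b hab := by
    obtain ⟨p, hpa, hpb⟩ := h.exists_parent_of_foll ((hfoll a b).1 (.single hab))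
    obtain ⟨q, rfl⟩ := hpred p a hpa
    exact ⟨q, hpa, hpb⟩
  next_unique := hnext
  foll_irrefl a ha := h.foll_irrefl _ ((hfoll a a).1 ha)
  foll_total p a b ha hb := by
    rw [hfoll, hfoll]
    exact (h.foll_total _ _ _ ha hb).imp_left fun e => hσ e

/-- The nodes that survive when the part of the tree between the spine nodes number `i`
and number `j` is cut out. -/
abbrev Kept (rank : T → ℕ) (i j : ℕ) : Type := {x : T // ¬ (i ≤ rank x ∧ rank x < j)}

open Classical in
/-- The node whose place `x` takes in the contracted tree: `c j` moves to the place of `c i`, and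
the other nodes stay where they are. -/
noncomputable def place (c : ℕ → T) {rank : T → ℕ} {i j : ℕ} (x : Kept rank i j) : T :=
  Equiv.swap (c i) (c j) x

/-- The tree with relations `child'` and `next'` arises by cutting out the nodes between `c i` and
`c j` and moving `c j` to the place of `c i`. Only the position of `c j` relative to nodes of
rank less than `i` changes. -/
structure IsContraction (child next : T → T → Prop) (c : ℕ → T) (rank : T → ℕ) (i j : ℕ)
    (child' next' : Kept rank i j → Kept rank i j → Prop) : Prop where
  isOrderedTree : IsOrderedTree child' next'
  relPos_above : ∀ x y, rank x.1 < i → y.1 = c j →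
    relPos child' next' x y = relPos child next x.1 (c i)
  relPos_eq : ∀ x y, ¬ (rank x.1 < i ∧ y.1 = c j) → ¬ (rank y.1 < i ∧ x.1 = c j) →
    relPos child' next' x y = relPos child next x.1 y.1

variable {c : ℕ → T} {rank : T → ℕ} {i j : ℕ}

theorem place_injective : (place c : Kept rank i j → T).Injective :=
  (Equiv.injective _).comp Subtype.val_injective

theorem place_of_eq {x : Kept rank i j} (hx : x.1 = c j) : place c x = c i := by
  classical
  rw [place, hx, Equiv.swap_apply_right]

theorem place_of_ne (hij : i < j) (hi : rank (c i) = i) {x : Kept rank i j} (hx : x.1 ≠ c j) :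
    place c x = x.1 := by
  classical
  exact Equiv.swap_apply_of_ne_of_ne (fun e => x.2 (by rw [e]; omega)) hx

theorem mem_range_place (hij : i < j) (hi : rank (c i) = i) (hj : rank (c j) = j) {x : T}
    (hx : x ≠ c i → ¬ (i ≤ rank x ∧ rank x < j) ∧ x ≠ c j) :
    x ∈ Set.range (place c : Kept rank i j → T) := by
  by_cases hxi : x = c i
  · exact ⟨⟨c j, by omega⟩, (place_of_eq rfl).trans hxi.symm⟩
  · exact ⟨⟨x, (hx hxi).1⟩, place_of_ne hij hi (hx hxi).2⟩

end Contraction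

section DownSpine

variable {T : Type} {child next : T → T → Prop} {d : ℕ} {c : ℕ → T} {rank : T → ℕ}

/-- `c 1, …, c d` is a `↓`-path, and `rank x` is the number of its nodes that are ancestors of `x`
or equal to `x`. -/
structure IsDownSpine (child : T → T → Prop) (d : ℕ) (c : ℕ → T) (rank : T → ℕ) : Prop where
  child_succ : ∀ l, 1 ≤ l → l < d → child (c l) (c (l + 1))
  le_rank_iff : ∀ {x l}, 1 ≤ l → l ≤ d → (l ≤ rank x ↔ ReflTransGen child (c l) x)
  rank_le : ∀ x, rank x ≤ d

theorem exists_isDownSpine (hc : ∀ l, 1 ≤ l → l < d → child (c l) (c (l + 1))) :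
    ∃ rank, IsDownSpine child d c rank := by
  classical
  refine ⟨fun x => Nat.findGreatest (fun l => ReflTransGen child (c l) x) d, hc,
    fun {x l} hl hld => ⟨fun hlr => ?_, fun h => Nat.le_findGreatest hld h⟩,
    fun x => Nat.findGreatest_le d⟩
  have hr := Nat.findGreatest_of_ne_zero (P := fun l => ReflTransGen child (c l) x) (n := d) rfl
    (by omega)
  rcases hlr.eq_or_lt with e | hlt
  · rwa [← e] at hr
  · exact (transGen_of_forall_succ hlt fun k hk hkr => hc k (hl.trans hk)
      (hkr.trans_le (Nat.findGreatest_le d))).to_reflTransGen.trans hr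

namespace IsDownSpine

theorem desc_spine (hs : IsDownSpine child d c rank) {s t : ℕ} (hs1 : 1 ≤ s) (hst : s < t)
    (htd : t ≤ d) : TransGen child (c s) (c t) :=
  transGen_of_forall_succ hst fun l hl hlt => hs.child_succ l (by omega) (by omega)

theorem child_pred (hs : IsDownSpine child d c rank) {l : ℕ} (hl : 2 ≤ l) (hld : l ≤ d) :
    child (c (l - 1)) (c l) := by
  have := hs.child_succ (l - 1) (by omega) (by omega)
  rwa [Nat.sub_add_cancel (by omega)] at this

theorem not_le_of_rank_lt (hs : IsDownSpine child d c rank) {x : T} {l : ℕ} (hx : rank x < l)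
    (hld : l ≤ d) : ¬ ReflTransGen child (c l) x := fun hc =>
  hx.not_ge ((hs.le_rank_iff (by omega) hld).2 hc)

theorem spine_rank_le (hs : IsDownSpine child d c rank) {x : T} (hx : 1 ≤ rank x) :
    ReflTransGen child (c (rank x)) x :=
  (hs.le_rank_iff hx (hs.rank_le x)).1 le_rfl

theorem rank_mono (hs : IsDownSpine child d c rank) {x y : T} (hxy : ReflTransGen child x y) :
    rank x ≤ rank y := by
  rcases Nat.eq_zero_or_pos (rank x) with hx | hx
  · omega
  · exact (hs.le_rank_iff hx (hs.rank_le x)).2 ((hs.spine_rank_le hx).trans hxy)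

theorem rank_spine (hs : IsDownSpine child d c rank) (h : IsOrderedTree child next) {l : ℕ}
    (hl : 1 ≤ l) (hld : l ≤ d) : rank (c l) = l := by
  refine le_antisymm (not_lt.1 fun hlt => ?_) ((hs.le_rank_iff hl hld).2 .refl)
  have hld := hs.rank_le (c l)
  exact h.desc_irrefl _ (TransGen.head' (hs.child_succ l hl (by omega))
    ((hs.le_rank_iff (by omega) (by omega)).1 hlt))

theorem desc_spine_iff (hs : IsDownSpine child d c rank) (h : IsOrderedTree child next) {b : T}
    {s : ℕ} (hb : 1 ≤ rank b) (hbs : rank b < s) (hsd : s ≤ d) :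
    TransGen child b (c s) ↔ b = c (rank b) := by
  refine ⟨fun hd => ?_, fun e => e ▸ hs.desc_spine hb hbs hsd⟩
  have hlow : ¬ ReflTransGen child (c (rank b + 1)) b := hs.not_le_of_rank_lt (by omega) (by omega)
  have hle : ReflTransGen child (c (rank b + 1)) (c s) :=
    (hs.le_rank_iff (by omega) (by omega)).1 ((hs.rank_spine h (by omega) hsd).symm ▸ hbs)
  have hb' := (h.le_total_of_le hd.to_reflTransGen hle).resolve_right hlow
  exact h.le_antisymm (h.le_parent hb' (hs.child_succ _ hb (by omega)) fun e => hlow (by rw [e]))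
    (hs.spine_rank_le hb)

theorem pos_above (hs : IsDownSpine child d c rank) (h : IsOrderedTree child next) {x b f : T}
    (hb : rank x < rank b) (hf : rank x < rank f) (hbne : b ≠ c (rank x + 1))
    (hfne : f ≠ c (rank x + 1)) : relPos child next x b = relPos child next x f := by
  have hbd := hs.rank_le b
  have hx : ¬ ReflTransGen child (c (rank x + 1)) x :=
    hs.not_le_of_rank_lt (by omega) (by omega)
  rw [h.relPos_of_subtree hx ((hs.le_rank_iff (by omega) (by omega)).1 hb) hbne,
    h.relPos_of_subtree hx ((hs.le_rank_iff (by omega) (by omega)).1 hf) hfne]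

theorem pos_below (hs : IsDownSpine child d c rank) (h : IsOrderedTree child next) {y b f : T}
    (hb1 : 1 ≤ rank b) (hf1 : 1 ≤ rank f) (hb : rank b < rank y) (hf : rank f < rank y)
    (hy : y = c (rank y) → rank b + 1 < rank y ∧ rank f + 1 < rank y)
    (hbf : b = c (rank b) ↔ f = c (rank f)) :
    relPos child next y b = relPos child next y f := by
  have hyd := hs.rank_le y
  obtain ⟨s, hbs, hfs, hsy, hne⟩ : ∃ s, rank b < s ∧ rank f < s ∧ s ≤ rank y ∧ y ≠ c s := by
    by_cases e : y = c (rank y)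
    · obtain ⟨hb2, hf2⟩ := hy e
      refine ⟨rank y - 1, by omega, by omega, by omega, fun e' => ?_⟩
      have := hs.rank_spine h (l := rank y - 1) (by omega) (by omega)
      rw [← e'] at this
      omega
    · exact ⟨rank y, hb, hf, le_rfl, e⟩
  have hle : ReflTransGen child (c s) y := (hs.le_rank_iff (by omega) (by omega)).1 hsy
  classical
  rw [h.relPos_flip b y, h.relPos_flip f y,
    h.relPos_of_subtree (hs.not_le_of_rank_lt hbs (by omega)) hle hne,
    h.relPos_of_subtree (hs.not_le_of_rank_lt hfs (by omega)) hle hne]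
  simp only [hs.desc_spine_iff h hb1 hbs (by omega), hs.desc_spine_iff h hf1 hfs (by omega), hbf]

theorem rank_of_sibling (hs : IsDownSpine child d c rank) (h : IsOrderedTree child next) {b : T}
    {i : ℕ} (hi : 2 ≤ i) (hid : i ≤ d)
    (hb : TransGen next (c i) b ∨ TransGen next b (c i)) : rank b + 1 = i := by
  have hpar := hs.child_pred hi hid
  have hb' : child (c (i - 1)) b := hb.elim (fun hb => (h.child_iff_of_foll hb).1 hpar)
    fun hb => (h.child_iff_of_foll hb).2 hpar
  have hne : c i ≠ b := by rintro rfl; exact hb.elim (h.foll_irrefl _) (h.foll_irrefl _)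
  have hlow := (hs.le_rank_iff (by omega) (by omega)).2 (.single hb')
  have hhigh := (hs.le_rank_iff (by omega) hid).not.2 (h.not_le_of_sibling hpar hb' hne)
  omega

theorem relPos_spine_eq_free (hs : IsDownSpine child d c rank) (h : IsOrderedTree child next)
    {b : T} {j : ℕ} (hjd : j ≤ d) (hb : 1 ≤ rank b) (hbj : rank b < j) (hne : b ≠ c (rank b))
    (hsib : ¬ TransGen next (c j) b ∧ ¬ TransGen next b (c j)) :
    relPos child next (c j) b = .free := by
  have hjb : ¬ ReflTransGen child (c j) b := hs.not_le_of_rank_lt hbj hjd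
  have hbj' : ¬ TransGen child b (c j) := (hs.desc_spine_iff h hb hbj hjd).not.2 hne
  exact h.relPos_eq_iff.2 ⟨fun e => hjb (e ▸ .refl), fun hc => hjb (.single hc),
    fun hc => hbj' (.single hc), fun hc => hjb hc.to_reflTransGen, hbj',
    fun hc => hsib.1 (.single hc), fun hc => hsib.2 (.single hc), hsib⟩

theorem pos_adjacent (hs : IsDownSpine child d c rank) (h : IsOrderedTree child next) {i j : ℕ}
    {b : T} (hi : 2 ≤ i) (hij : i < j) (hjd : j ≤ d) (hbj : rank b + 1 = j) :
    (∀ f, 1 ≤ rank f → rank f + 1 < j → (b = c (rank b) ↔ f = c (rank f)) →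
      relPos child next (c j) b = relPos child next (c j) f) ∨
    ∀ b', relPos child next (c i) b' = relPos child next (c j) b → rank b' + 1 = i := by
  by_cases hspine : b = c (rank b)
  · refine .inr fun b' hb' => ?_
    have hup : relPos child next (c j) b = .up := h.relPos_eq_iff.2 <| by
      rw [hspine, show rank b = j - 1 by omega]
      exact hs.child_pred (by omega) hjd
    have hb'i : child b' (c i) := h.relPos_eq_iff.1 (hb'.trans hup)
    rw [h.parent_unique _ _ _ hb'i (hs.child_pred hi (by omega)),
      hs.rank_spine h (by omega) (by omega)]
    omega
  by_cases hsib : TransGen next (c j) b ∨ TransGen next b (c j)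
  · refine .inr fun b' hb' => hs.rank_of_sibling h hi (by omega) (hsib.imp ?_ ?_)
    · exact (h.navAgree_of_relPos_eq h hb').foll_iff.2
    · refine (h.navAgree_of_relPos_eq h ?_).foll_iff.2
      rw [h.relPos_flip (c i), hb', ← h.relPos_flip]
  · refine .inl fun f hf hfj hbf => ?_
    rw [hs.relPos_spine_eq_free h hjd (by omega) (by omega) hspine (not_or.1 hsib),
      hs.relPos_spine_eq_free h hjd hf (by omega) (hbf.not.1 hspine)]
    rw [← not_or]
    intro hf'
    have := hs.rank_of_sibling h (by omega) hjd hf'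
    omega

theorem isSpine (hs : IsDownSpine child d c rank) (h : IsOrderedTree child next) :
    IsSpine (relPos child next) d c rank where
  rank_spine _ hl hld := hs.rank_spine h hl hld
  pos_above _ _ _ hb hf hbne hfne _ := hs.pos_above h hb hf hbne hfne
  pos_below _ _ _ hb1 hf1 hb hf hy hbf := hs.pos_below h hb1 hf1 hb hf hy hbf
  pos_adjacent _ _ _ hi hij hjd hbj := hs.pos_adjacent h hi hij hjd hbj

variable {i j : ℕ}

theorem kept_of_child_place (hs : IsDownSpine child d c rank) (h : IsOrderedTree child next)
    (hi : 1 ≤ i) (hij : i < j) (hjd : j ≤ d) {a : T} {b : Kept rank i j}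
    (hab : child a (place c b)) : ¬ (i ≤ rank a ∧ rank a < j) := by
  rintro ⟨hia, haj⟩
  by_cases hb : b.1 = c j
  · rw [place_of_eq hb] at hab
    exact h.desc_irrefl _ (TransGen.tail' ((hs.le_rank_iff hi (by omega)).1 hia) hab)
  · rw [place_of_ne hij (hs.rank_spine h hi (by omega)) hb] at hab
    have hjb : j ≤ rank b.1 := not_lt.1 fun hlt =>
      b.2 ⟨hia.trans (hs.rank_mono (.single hab)), hlt⟩
    exact hs.not_le_of_rank_lt haj hjd
      (h.le_parent ((hs.le_rank_iff (by omega) hjd).1 hjb) hab hb)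

theorem mem_range_place_of_child (hs : IsDownSpine child d c rank) (h : IsOrderedTree child next)
    (hi : 1 ≤ i) (hij : i < j) (hjd : j ≤ d) {p a : T} (hp : ¬ (i ≤ rank p ∧ rank p < j))
    (hpa : child p a) : a ∈ Set.range (place c : Kept rank i j → T) := by
  have hri := hs.rank_spine h hi (by omega)
  have hrj := hs.rank_spine h (by omega) hjd
  refine mem_range_place hij hri hrj fun hne => ?_
  by_cases hia : i ≤ rank a
  · have hip : i ≤ rank p := (hs.le_rank_iff hi (by omega)).2
      (h.le_parent ((hs.le_rank_iff hi (by omega)).1 hia) hpa hne)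
    have hjp : ReflTransGen child (c j) p := (hs.le_rank_iff (by omega) hjd).1 (by omega)
    refine ⟨fun hc => hs.not_le_of_rank_lt hc.2 hjd (hjp.tail hpa), ?_⟩
    rintro rfl
    exact h.desc_irrefl _ (TransGen.tail' hjp hpa)
  · exact ⟨fun hc => hia hc.1, by rintro rfl; omega⟩

theorem desc_contract_iff [Finite T] (hs : IsDownSpine child d c rank)
    (h : IsOrderedTree child next) (hi : 1 ≤ i) (hij : i < j) (hjd : j ≤ d)
    {a b : Kept rank i j} :
    TransGen (fun a b : Kept rank i j => child a.1 (place c b)) a b ↔ TransGen child a.1 b.1 := by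
  classical
  have huv := hs.desc_spine hi hij hjd
  refine transGen_contract_iff h.desc_irrefl h.leftUnique_child huv
    (fun a b hab => hs.kept_of_child_place h hi hij hjd (b := b) hab) fun z hiz hzj => not_not.2
      ⟨(hs.le_rank_iff hi (by omega)).2 hiz, not_le.1 fun hjz => ?_⟩
  exact h.desc_irrefl _ (hzj.trans_left ((hs.le_rank_iff (by omega) hjd).1 hjz))

theorem foll_contract_iff (hs : IsDownSpine child d c rank) (h : IsOrderedTree child next)
    (hi : 1 ≤ i) (hij : i < j) (hjd : j ≤ d) {a b : Kept rank i j} :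
    TransGen (fun a b : Kept rank i j => next (place c a) (place c b)) a b ↔
      TransGen next (place c a) (place c b) := by
  refine transGen_onFun_iff fun a b hab => ?_
  obtain ⟨p, hpa, hpb⟩ := h.next_siblings _ _ hab
  exact hs.mem_range_place_of_child h hi hij hjd (hs.kept_of_child_place h hi hij hjd hpb) hpa

theorem isOrderedTree_contract [Finite T] (hs : IsDownSpine child d c rank)
    (h : IsOrderedTree child next) (hi : 2 ≤ i) (hij : i < j) (hjd : j ≤ d) :
    IsOrderedTree (fun a b : Kept rank i j => child a.1 (place c b))
      (fun a b => next (place c a) (place c b)) := by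
  refine h.of_embedding Subtype.val_injective place_injective (fun r hr => ?_)
    (fun a b hab => ⟨⟨a, hs.kept_of_child_place h (by omega) hij hjd hab⟩, rfl⟩)
    (fun a b => (hs.desc_contract_iff h (by omega) hij hjd).2)
    (fun a b c hb hc => place_injective (h.next_unique _ _ _ hb hc))
    fun a b => hs.foll_contract_iff h (by omega) hij hjd
  have hir : ¬ ReflTransGen child (c i) r := by
    intro hc
    rcases ReflTransGen.cases_tail hc with rfl | ⟨p, -, hp⟩
    · exact hr _ (hs.child_pred hi (by omega))
    · exact hr p hp
  refine ⟨⟨r, fun hc => hir ((hs.le_rank_iff (by omega) (by omega)).1 hc.1)⟩, rfl,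
    place_of_ne hij (hs.rank_spine h (by omega) (by omega)) ?_⟩
  rintro rfl
  exact hir (hs.desc_spine (by omega) hij hjd).to_reflTransGen

theorem relPos_contract_above [Finite T] (hs : IsDownSpine child d c rank)
    (h : IsOrderedTree child next) (hi : 2 ≤ i) (hij : i < j) (hjd : j ≤ d) {x y : Kept rank i j}
    (hx : rank x.1 < i) (hy : y.1 = c j) :
    relPos (fun a b : Kept rank i j => child a.1 (place c b))
      (fun a b => next (place c a) (place c b)) x y = relPos child next x.1 (c i) := by
  have hri := hs.rank_spine h (l := i) (by omega) (by omega)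
  have hrj := hs.rank_spine h (l := j) (by omega) hjd
  have huv := hs.desc_spine (by omega) hij hjd
  have hxj : x.1 ≠ c j := by rintro e; rw [e] at hx; omega
  have hxi : x.1 ≠ c i := by rintro e; rw [e] at hx; omega
  have hix : ¬ ReflTransGen child (c i) x := hs.not_le_of_rank_lt hx (by omega)
  have hjx : ¬ ReflTransGen child (c j) x := hs.not_le_of_rank_lt (by omega) hjd
  have desc_spine_iff : TransGen child x (c j) ↔ TransGen child x (c i) := by
    refine ⟨fun hc => ?_, fun hc => hc.trans huv⟩
    exact (reflTransGen_iff_eq_or_transGen.1 ((h.le_total_of_le hc.to_reflTransGen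
      huv.to_reflTransGen).resolve_right hix)).resolve_left hxi.symm
  refine relPos_congr ⟨?_, ?_, ?_, ?_, ?_⟩ ⟨?_, ?_, ?_, ?_, ?_⟩ <;>
    simp only [hs.desc_contract_iff h (by omega) hij hjd, hs.foll_contract_iff h (by omega) hij hjd,
      place_of_eq hy, place_of_ne hij hri hxj, Subtype.ext_iff, hy]
  · exact iff_of_false hxj hxi
  · exact desc_spine_iff
  · exact iff_of_false hxj.symm hxi.symm
  · exact iff_of_false (fun hc => hjx (.single hc)) fun hc => hix (.single hc)
  · exact iff_of_false (fun hc => hjx hc.to_reflTransGen) fun hc => hix hc.to_reflTransGen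

theorem relPos_contract_below [Finite T] (hs : IsDownSpine child d c rank)
    (h : IsOrderedTree child next) (hi : 2 ≤ i) (hij : i < j) (hjd : j ≤ d) {x y : Kept rank i j}
    (hx : x.1 = c j) (hy : i ≤ rank y.1) :
    relPos (fun a b : Kept rank i j => child a.1 (place c b))
      (fun a b => next (place c a) (place c b)) x y = relPos child next x.1 y.1 := by
  have hjy : ReflTransGen child (c j) y :=
    (hs.le_rank_iff (by omega) hjd).1 (not_lt.1 fun hlt => y.2 ⟨hy, hlt⟩)
  rcases reflTransGen_iff_eq_or_transGen.1 hjy with hy | hjy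
  · rw [Subtype.ext (hy.trans hx.symm), relPos_self, relPos_self]
  · classical
    have hyj : y.1 ≠ c j := fun e => h.desc_irrefl _ (e ▸ hjy)
    rw [← hx] at hjy
    rw [(hs.isOrderedTree_contract h hi hij hjd).relPos_of_desc
        ((hs.desc_contract_iff h (by omega) hij hjd).2 hjy), h.relPos_of_desc hjy,
      place_of_ne hij (hs.rank_spine h (by omega) (by omega)) hyj]

theorem isContraction [Finite T] (hs : IsDownSpine child d c rank) (h : IsOrderedTree child next)
    (hi : 2 ≤ i) (hij : i < j) (hjd : j ≤ d) :
    IsContraction child next c rank i j (fun a b => child a.1 (place c b))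
      (fun a b => next (place c a) (place c b)) where
  isOrderedTree := hs.isOrderedTree_contract h hi hij hjd
  relPos_above _ _ hx hy := hs.relPos_contract_above h hi hij hjd hx hy
  relPos_eq x y hxy hyx := by
    have htree := hs.isOrderedTree_contract h hi hij hjd
    have place_ne := fun x => place_of_ne hij (hs.rank_spine h (by omega) (by omega)) (x := x)
    by_cases hx : x.1 = c j
    · exact hs.relPos_contract_below h hi hij hjd hx (not_lt.1 fun hlt => hyx ⟨hlt, hx⟩)
    by_cases hy : y.1 = c j
    · rw [htree.relPos_flip y x, h.relPos_flip y.1 x.1,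
        hs.relPos_contract_below h hi hij hjd hy (not_lt.1 fun hlt => hxy ⟨hlt, hy⟩)]
    · refine relPos_congr ⟨?_, ?_, ?_, ?_, ?_⟩ ⟨?_, ?_, ?_, ?_, ?_⟩ <;>
        simp only [hs.desc_contract_iff h (by omega) hij hjd,
          hs.foll_contract_iff h (by omega) hij hjd, place_ne x hx, place_ne y hy, Subtype.ext_iff]

end IsDownSpine

end DownSpine

section RightSpine

variable {T : Type} {child next : T → T → Prop} {p : T} {d : ℕ} {c : ℕ → T} {rank : T → ℕ}

/-- `c 1, …, c d` are the children of `p` from left to right, and `rank x = l` for the nodes `x` in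
the subtree of `c l`; nodes outside these subtrees have rank `0`. -/
structure IsRightSpine (child next : T → T → Prop) (p : T) (d : ℕ) (c : ℕ → T)
    (rank : T → ℕ) : Prop where
  child_spine : ∀ l, 1 ≤ l → l ≤ d → child p (c l)
  eq_spine : ∀ {x}, child p x → 1 ≤ rank x ∧ x = c (rank x)
  next_succ : ∀ l, 1 ≤ l → l < d → next (c l) (c (l + 1))
  rank_eq_iff : ∀ {x l}, 1 ≤ l → l ≤ d → (rank x = l ↔ ReflTransGen child (c l) x)
  rank_le : ∀ x, rank x ≤ d

theorem exists_enum_of_isStrictTotalOrder {S : Type} [Finite S] (r : S → S → Prop)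
    [IsStrictTotalOrder S r] :
    ∃ e : Fin (Nat.card S) → S, e.Surjective ∧ ∀ s t, s < t → r (e s) (e t) := by
  classical
  have := Fintype.ofFinite S
  let := linearOrderOfSTO r
  let e := Fintype.orderIsoFinOfCardEq S Nat.card_eq_fintype_card.symm
  exact ⟨e, e.surjective, fun _ _ hst => e.strictMono hst⟩

theorem IsOrderedTree.exists_enum_children [Finite T] (h : IsOrderedTree child next) (p : T) :
    ∃ c : ℕ → T, (∀ x, child p x ↔ ∃ l, 1 ≤ l ∧ l ≤ Set.ncard {b | child p b} ∧ x = c l) ∧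
      ∀ s t, 1 ≤ s → s < t → t ≤ Set.ncard {b | child p b} → TransGen next (c s) (c t) := by
  have : IsStrictTotalOrder {b | child p b} (fun a b => TransGen next a.1 b.1) :=
    { irrefl := fun a => h.foll_irrefl a.1
      trans := fun _ _ _ => TransGen.trans
      trichotomous := fun a b hab hba => Subtype.ext
        (((h.foll_total p a b a.2 b.2).resolve_right (not_or.2 ⟨hab, hba⟩))) }
  obtain ⟨e, hsurj, hmono⟩ := exists_enum_of_isStrictTotalOrder
    (fun a b : {b | child p b} => TransGen next a.1 b.1)
  let c : ℕ → T := fun l => if hl : l - 1 < Nat.card {b | child p b} then (e ⟨l - 1, hl⟩).1 else p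
  have hc : ∀ l (hl : l - 1 < Nat.card {b | child p b}), c l = (e ⟨l - 1, hl⟩).1 :=
    fun l hl => dif_pos hl
  simp only [← Nat.card_coe_set_eq]
  refine ⟨c, fun x => ⟨fun hx => ?_, ?_⟩, fun s t hs hst ht => ?_⟩
  · obtain ⟨l, hl⟩ := hsurj ⟨x, hx⟩
    exact ⟨l + 1, by omega, l.isLt, (congrArg Subtype.val hl.symm).trans (hc (l + 1) l.isLt).symm⟩
  · rintro ⟨l, hl, hld, rfl⟩
    rw [hc l (by omega)]
    exact (e _).2
  · rw [hc s (by omega), hc t (by omega)]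
    exact hmono _ _ (Fin.mk_lt_mk.2 (by omega))

theorem exists_isRightSpine [Finite T] (h : IsOrderedTree child next) (p : T) :
    ∃ c rank, IsRightSpine child next p (Set.ncard {b | child p b}) c rank := by
  obtain ⟨c, hchild, hfoll⟩ := h.exists_enum_children p
  generalize Set.ncard {b | child p b} = d at hchild hfoll
  have child_c : ∀ l, 1 ≤ l → l ≤ d → child p (c l) :=
    fun l hl hld => (hchild _).2 ⟨l, hl, hld, rfl⟩
  have lt_of_foll : ∀ s t, 1 ≤ t → s ≤ d → TransGen next (c s) (c t) → s < t := by
    refine fun s t ht hs hst => not_le.1 fun hts => ?_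
    rcases hts.eq_or_lt with rfl | hts
    · exact h.foll_irrefl _ hst
    · exact h.foll_irrefl _ (hst.trans (hfoll t s ht hts hs))
  have c_inj : ∀ s t, 1 ≤ s → s ≤ d → 1 ≤ t → t ≤ d → c s = c t → s = t := by
    refine fun s t hs hsd ht htd e => (lt_trichotomy s t).elim (fun hst => ?_) fun hst =>
      hst.elim id fun hst => ?_
    · exact absurd (hfoll s t hs hst htd) (e ▸ h.foll_irrefl _)
    · exact absurd (hfoll t s ht hst hsd) (e ▸ h.foll_irrefl _)
  classical
  have exists_rank : ∀ x, ∃ r ≤ d, ∀ l, 1 ≤ l → l ≤ d → (r = l ↔ ReflTransGen child (c l) x) := by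
    intro x
    by_cases hx : ∃ l, 1 ≤ l ∧ l ≤ d ∧ ReflTransGen child (c l) x
    · obtain ⟨l, hl, hld, hlx⟩ := hx
      exact ⟨l, hld, fun t ht htd => ⟨fun e => e ▸ hlx, fun htx => c_inj l t hl hld ht htd
        (h.eq_of_sibling_of_le (child_c l hl hld) (child_c t ht htd) hlx htx)⟩⟩
    · exact ⟨0, Nat.zero_le _, fun t ht htd => ⟨by omega, fun htx => absurd ⟨t, ht, htd, htx⟩ hx⟩⟩
  choose rank rank_le rank_eq using exists_rank
  refine ⟨c, rank, child_c, fun {x} hx => ?_, fun l hl hld => ?_, rank_eq _ _, rank_le⟩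
  · obtain ⟨l, hl, hld, rfl⟩ := (hchild x).1 hx
    rw [(rank_eq (c l) l hl hld).2 .refl]
    exact ⟨hl, rfl⟩
  · obtain ⟨z, hz, hzl⟩ := TransGen.head'_iff.1 (hfoll l (l + 1) hl (by omega) hld)
    obtain ⟨t, ht, htd, rfl⟩ := (hchild z).1 ((h.child_iff_of_next hz).1 (child_c l hl hld.le))
    have hlt := lt_of_foll l t ht hld.le (.single hz)
    rcases reflTransGen_iff_eq_or_transGen.1 hzl with e | hzl
    · rwa [e]
    · have := lt_of_foll t (l + 1) (by omega) htd hzl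
      omega

namespace IsRightSpine

theorem rank_spine (hs : IsRightSpine child next p d c rank) {l : ℕ} (hl : 1 ≤ l) (hld : l ≤ d) :
    rank (c l) = l :=
  (hs.rank_eq_iff hl hld).2 .refl

theorem foll_spine (hs : IsRightSpine child next p d c rank) {s t : ℕ} (hs1 : 1 ≤ s)
    (hst : s < t) (htd : t ≤ d) : TransGen next (c s) (c t) :=
  transGen_of_forall_succ hst fun l hl hlt => hs.next_succ l (by omega) (by omega)

theorem spine_rank_le (hs : IsRightSpine child next p d c rank) {x : T} (hx : 1 ≤ rank x) :
    ReflTransGen child (c (rank x)) x :=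
  (hs.rank_eq_iff hx (hs.rank_le x)).1 rfl

theorem not_le_of_rank_ne (hs : IsRightSpine child next p d c rank) {x : T} {l : ℕ} (hl : 1 ≤ l)
    (hld : l ≤ d) (hx : rank x ≠ l) : ¬ ReflTransGen child (c l) x :=
  (hs.rank_eq_iff hl hld).not.1 hx

theorem rank_eq_of_le (hs : IsRightSpine child next p d c rank) {x y : T} (hx : 1 ≤ rank x)
    (hxy : ReflTransGen child x y) : rank y = rank x :=
  (hs.rank_eq_iff hx (hs.rank_le x)).2 ((hs.spine_rank_le hx).trans hxy)

theorem rank_of_foll (hs : IsRightSpine child next p d c rank) (h : IsOrderedTree child next)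
    {x y : T} (hp : child p x ∨ child p y) (hxy : TransGen next x y) :
    (1 ≤ rank x ∧ x = c (rank x)) ∧ rank x < rank y ∧ y = c (rank y) := by
  have hpx : child p x := hp.elim id (h.child_iff_of_foll hxy).2
  obtain ⟨hx, hxc⟩ := hs.eq_spine hpx
  obtain ⟨hy, hyc⟩ := hs.eq_spine ((h.child_iff_of_foll hxy).1 hpx)
  refine ⟨⟨hx, hxc⟩, not_le.1 fun hle => ?_, hyc⟩
  rcases hle.eq_or_lt with e | hlt
  · exact h.foll_irrefl x (by rwa [hyc, e, ← hxc] at hxy)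
  · have hyx := hs.foll_spine hy hlt (hs.rank_le x)
    rw [← hyc, ← hxc] at hyx
    exact h.foll_irrefl x (hxy.trans hyx)

theorem relPos_spine (hs : IsRightSpine child next p d c rank) (h : IsOrderedTree child next)
    {s t : ℕ} (hs1 : 1 ≤ s) (hst : s + 1 < t) (htd : t ≤ d) :
    relPos child next (c s) (c t) = .rightRight := by
  refine h.relPos_eq_iff.2 ⟨hs.foll_spine hs1 (by omega) htd, fun hn => ?_⟩
  have hfoll := hs.foll_spine (by omega) hst htd
  rw [h.next_unique _ _ _ hn (hs.next_succ s hs1 (by omega))] at hfoll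
  exact h.foll_irrefl _ hfoll

open Classical in
theorem relPos_off_spine (hs : IsRightSpine child next p d c rank) (h : IsOrderedTree child next)
    {x b : T} (hb : 1 ≤ rank b) (hx : rank x ≠ rank b) (hne : b ≠ c (rank b)) :
    relPos child next x b = if ReflTransGen child x p then .downDown else .free := by
  rw [h.relPos_of_subtree (hs.not_le_of_rank_ne hb (hs.rank_le b) hx) (hs.spine_rank_le hb) hne]
  simp only [h.desc_iff_le_parent (hs.child_spine _ hb (hs.rank_le b))]

open Classical in
theorem relPos_to_spine (hs : IsRightSpine child next p d c rank) (h : IsOrderedTree child next)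
    {x : T} {t : ℕ} (ht : 1 ≤ t) (htd : t ≤ d) (hx : rank x ≠ t)
    (hne : rank x = 0 ∨ x ≠ c (rank x)) :
    relPos child next x (c t) = if x = p then .down else
      if ReflTransGen child x p then .downDown else .free := by
  have hp := hs.child_spine t ht htd
  have hdesc : TransGen child x (c t) ↔ ReflTransGen child x p := h.desc_iff_le_parent hp
  split_ifs with hxp hxp' <;> rw [h.relPos_eq_iff]
  · rwa [hxp]
  · exact ⟨hdesc.2 hxp', fun hc => hxp (h.parent_unique _ _ _ hc hp)⟩
  · have hup := hs.not_le_of_rank_ne ht htd hx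
    have hdn : ¬ TransGen child x (c t) := hdesc.not.2 hxp'
    have hsib : ¬ child p x := fun hc => by
      obtain ⟨h1, hxc⟩ := hs.eq_spine hc
      exact hne.elim (by omega) fun hne => hne hxc
    have hf : ¬ TransGen next x (c t) := fun hc => hsib ((h.child_iff_of_foll hc).2 hp)
    have hf' : ¬ TransGen next (c t) x := fun hc => hsib ((h.child_iff_of_foll hc).1 hp)
    exact ⟨fun e => hup (e ▸ .refl), fun hc => hdn (.single hc), fun hc => hup (.single hc), hdn,
      fun hc => hup hc.to_reflTransGen, fun hc => hf (.single hc), fun hc => hf' (.single hc),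
      hf, hf'⟩

theorem pos_above (hs : IsRightSpine child next p d c rank) (h : IsOrderedTree child next)
    {x b f : T} (hb : rank x < rank b) (hf : rank x < rank f) (hbne : b ≠ c (rank x + 1))
    (hfne : f ≠ c (rank x + 1)) (hbf : b = c (rank b) ↔ f = c (rank f)) :
    relPos child next x b = relPos child next x f := by
  classical
  by_cases hspine : b = c (rank b)
  · have hspine' := hbf.1 hspine
    by_cases hx : rank x = 0 ∨ x ≠ c (rank x)
    · rw [hspine, hspine', hs.relPos_to_spine h (by omega) (hs.rank_le b) hb.ne hx,
        hs.relPos_to_spine h (by omega) (hs.rank_le f) hf.ne hx]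
    · rw [not_or, not_not] at hx
      have hb2 : rank x + 1 ≠ rank b := fun e => hbne (e ▸ hspine)
      have hf2 : rank x + 1 ≠ rank f := fun e => hfne (e ▸ hspine')
      rw [hspine, hspine', hx.2, hs.relPos_spine h (by omega) (by omega) (hs.rank_le b),
        hs.relPos_spine h (by omega) (by omega) (hs.rank_le f)]
  · rw [hs.relPos_off_spine h (by omega) hb.ne hspine,
      hs.relPos_off_spine h (by omega) hf.ne (hbf.not.1 hspine)]

theorem pos_below (hs : IsRightSpine child next p d c rank) (h : IsOrderedTree child next)
    {y b f : T} (hb1 : 1 ≤ rank b) (hf1 : 1 ≤ rank f) (hb : rank b < rank y)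
    (hf : rank f < rank y) (hy : y = c (rank y) → rank b + 1 < rank y ∧ rank f + 1 < rank y)
    (hbf : b = c (rank b) ↔ f = c (rank f)) :
    relPos child next y b = relPos child next y f := by
  classical
  by_cases hspine : b = c (rank b)
  · have hspine' := hbf.1 hspine
    by_cases hys : y = c (rank y)
    · obtain ⟨hb2, hf2⟩ := hy hys
      rw [h.relPos_flip b y, h.relPos_flip f y, hspine, hspine', hys,
        hs.relPos_spine h hb1 hb2 (hs.rank_le y), hs.relPos_spine h hf1 hf2 (hs.rank_le y)]
    · rw [hspine, hspine', hs.relPos_to_spine h hb1 (hs.rank_le b) hb.ne' (.inr hys),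
        hs.relPos_to_spine h hf1 (hs.rank_le f) hf.ne' (.inr hys)]
  · rw [hs.relPos_off_spine h hb1 hb.ne' hspine,
      hs.relPos_off_spine h hf1 hf.ne' (hbf.not.1 hspine)]

theorem pos_adjacent (hs : IsRightSpine child next p d c rank) (h : IsOrderedTree child next)
    {i j : ℕ} {b : T} (hi : 2 ≤ i) (hij : i < j) (hjd : j ≤ d) (hbj : rank b + 1 = j) :
    (∀ f, 1 ≤ rank f → rank f + 1 < j → (b = c (rank b) ↔ f = c (rank f)) →
      relPos child next (c j) b = relPos child next (c j) f) ∨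
    ∀ b', relPos child next (c i) b' = relPos child next (c j) b → rank b' + 1 = i := by
  by_cases hspine : b = c (rank b)
  · refine .inr fun b' hb' => ?_
    have hbc := hs.next_succ (rank b) (by omega) (by omega)
    rw [hbj, ← hspine] at hbc
    have hleft : relPos child next (c i) b' = .left := hb'.trans (h.relPos_eq_iff.2 hbc)
    have hic := hs.next_succ (i - 1) (by omega) (by omega)
    rw [Nat.sub_add_cancel (by omega)] at hic
    rw [h.leftUnique_next (h.relPos_eq_iff.1 hleft) hic, hs.rank_spine (by omega) (by omega)]
    omega
  · classical
    have hrj := hs.rank_spine (l := j) (by omega) hjd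
    refine .inl fun f hf hfj hbf => ?_
    rw [hs.relPos_off_spine h (by omega) (by omega) hspine,
      hs.relPos_off_spine h hf (by omega) (hbf.not.1 hspine)]

theorem isSpine (hs : IsRightSpine child next p d c rank) (h : IsOrderedTree child next) :
    IsSpine (relPos child next) d c rank where
  rank_spine _ hl hld := hs.rank_spine hl hld
  pos_above _ _ _ hb hf hbne hfne hbf := hs.pos_above h hb hf hbne hfne hbf
  pos_below _ _ _ hb1 hf1 hb hf hy hbf := hs.pos_below h hb1 hf1 hb hf hy hbf
  pos_adjacent _ _ _ hi hij hjd hbj := hs.pos_adjacent h hi hij hjd hbj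

variable {i j : ℕ}

theorem kept_of_child (hs : IsRightSpine child next p d c rank) (hi : 1 ≤ i) {a : T}
    {b : Kept rank i j} (hab : child a b) : ¬ (i ≤ rank a ∧ rank a < j) := fun ha =>
  b.2 (by rwa [hs.rank_eq_of_le (by omega) (.single hab)])

theorem rank_lt_of_foll_spine (hs : IsRightSpine child next p d c rank)
    (h : IsOrderedTree child next) {x : T} {l : ℕ} (hl : 1 ≤ l) (hld : l ≤ d)
    (hx : TransGen next x (c l)) : rank x < l := by
  have := (hs.rank_of_foll h (.inr (hs.child_spine l hl hld)) hx).2.1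
  rwa [hs.rank_spine hl hld] at this

theorem kept_of_next_place (hs : IsRightSpine child next p d c rank) (h : IsOrderedTree child next)
    (hi : 1 ≤ i) (hij : i < j) (hjd : j ≤ d) {a : T} {b : Kept rank i j}
    (hab : next a (place c b)) : ¬ (i ≤ rank a ∧ rank a < j) := by
  rintro ⟨hia, haj⟩
  by_cases hb : b.1 = c j
  · rw [place_of_eq hb] at hab
    exact (hs.rank_lt_of_foll_spine h hi (by omega) (.single hab)).not_ge hia
  rw [place_of_ne hij (hs.rank_spine hi (by omega)) hb] at hab
  by_cases ha : a = c (rank a)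
  · have hac := hs.next_succ (rank a) (by omega) (by omega)
    rw [← ha] at hac
    have e := h.next_unique _ _ _ hab hac
    have hrb := hs.rank_spine (l := rank a + 1) (by omega) (by omega)
    rw [← e] at hrb
    rcases Nat.lt_or_ge (rank a + 1) j with hlt | hge
    · exact b.2 (by omega)
    · exact hb (e.trans (congrArg c (by omega)))
  · obtain ⟨q, hqa, hqb⟩ := h.next_siblings _ _ hab
    have hq := h.le_parent (hs.spine_rank_le (by omega)) hqa ha
    exact b.2 (by rw [(hs.rank_eq_iff (by omega) (by omega)).2 (hq.tail hqb)]; omega)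

theorem foll_contract_iff [Finite T] (hs : IsRightSpine child next p d c rank)
    (h : IsOrderedTree child next) (hi : 1 ≤ i) (hij : i < j) (hjd : j ≤ d)
    {a b : Kept rank i j} :
    TransGen (fun a b : Kept rank i j => next a.1 (place c b)) a b ↔ TransGen next a.1 b.1 := by
  classical
  refine transGen_contract_iff h.foll_irrefl h.leftUnique_next (hs.foll_spine hi hij hjd)
    (fun a b hab => hs.kept_of_next_place h hi hij hjd (b := b) hab) fun z hiz hzj => not_not.2
      ⟨?_, hs.rank_lt_of_foll_spine h (by omega) hjd hzj⟩
  have hri := hs.rank_spine hi (by omega)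
  rcases reflTransGen_iff_eq_or_transGen.1 hiz with rfl | hiz
  · exact hri.ge
  · exact hri.ge.trans (hs.rank_of_foll h (.inl (hs.child_spine i hi (by omega))) hiz).2.1.le

theorem isOrderedTree_contract [Finite T] (hs : IsRightSpine child next p d c rank)
    (h : IsOrderedTree child next) (hi : 1 ≤ i) (hij : i < j) (hjd : j ≤ d) :
    IsOrderedTree (fun a b : Kept rank i j => child a.1 b.1) (fun a b => next a.1 (place c b)) := by
  refine h.of_embedding Subtype.val_injective Subtype.val_injective (fun r hr => ?_)
    (fun a b hab => ⟨⟨a, hs.kept_of_child hi hab⟩, rfl⟩)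
    (fun a b => (transGen_onFun_iff fun a b hab => ⟨⟨a, hs.kept_of_child hi hab⟩, rfl⟩).2)
    (fun a b c hb hc => place_injective (h.next_unique _ _ _ hb hc))
    fun a b => hs.foll_contract_iff h hi hij hjd
  refine ⟨⟨r, fun hc => ?_⟩, rfl, rfl⟩
  rcases ReflTransGen.cases_tail (hs.spine_rank_le (by omega : 1 ≤ rank r)) with e | ⟨q, -, hq⟩
  · exact hr p (e ▸ hs.child_spine _ (by omega) (hs.rank_le r))
  · exact hr q hq

theorem next_place_iff (hs : IsRightSpine child next p d c rank) (h : IsOrderedTree child next)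
    (hi : 1 ≤ i) (hij : i < j) (hjd : j ≤ d) {x y : Kept rank i j}
    (hxy : ¬ (rank x.1 < i ∧ y.1 = c j)) : next x.1 (place c y) ↔ next x.1 y.1 := by
  by_cases hy : y.1 = c j
  · have hx : j ≤ rank x.1 := not_lt.1 fun hlt => x.2 ⟨not_lt.1 fun hlt => hxy ⟨hlt, hy⟩, hlt⟩
    rw [place_of_eq hy, hy]
    refine iff_of_false (fun hc => ?_) fun hc => ?_
    · have := hs.rank_lt_of_foll_spine h hi (by omega) (.single hc)
      omega
    · have := hs.rank_lt_of_foll_spine h (by omega) hjd (.single hc)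
      omega
  · rw [place_of_ne hij (hs.rank_spine hi (by omega)) hy]

theorem relPos_contract_above [Finite T] (hs : IsRightSpine child next p d c rank)
    (h : IsOrderedTree child next) (hi : 1 ≤ i) (hij : i < j) (hjd : j ≤ d) {x y : Kept rank i j}
    (hx : rank x.1 < i) (hy : y.1 = c j) :
    relPos (fun a b : Kept rank i j => child a.1 b.1) (fun a b => next a.1 (place c b)) x y =
      relPos child next x.1 (c i) := by
  have hri := hs.rank_spine (l := i) hi (by omega)
  have hrj := hs.rank_spine (l := j) (by omega) hjd
  have hpi := hs.child_spine i hi (by omega)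
  have hpj := hs.child_spine j (by omega) hjd
  have hxj : x.1 ≠ c j := by rintro e; rw [e] at hx; omega
  have hxi : x.1 ≠ c i := by rintro e; rw [e] at hx; omega
  have hix := hs.not_le_of_rank_ne hi (by omega) hx.ne
  have hjx := hs.not_le_of_rank_ne (l := j) (x := x.1) (by omega) hjd (by omega)
  have not_foll : ∀ l, i ≤ l → l ≤ d → ¬ TransGen next (c l) x := fun l hl hld hc => by
    have := (hs.rank_of_foll h (.inl (hs.child_spine l (by omega) hld)) hc).2.1
    rw [hs.rank_spine (by omega) hld] at this
    omega
  have foll_spine_iff : TransGen next x (c j) ↔ TransGen next x (c i) := by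
    refine ⟨fun hc => ?_, fun hc => hc.trans (hs.foll_spine hi hij hjd)⟩
    obtain ⟨hx1, hxc⟩ := (hs.rank_of_foll h (.inr hpj) hc).1
    rw [hxc]
    exact hs.foll_spine hx1 hx (by omega)
  refine relPos_congr ⟨?_, ?_, ?_, ?_, ?_⟩ ⟨?_, ?_, ?_, ?_, ?_⟩ <;>
    simp only [transGen_onFun_iff (R := child) (e := Subtype.val) fun a (_ : Kept rank i j) hab =>
        ⟨⟨a, hs.kept_of_child hi hab⟩, rfl⟩,
      hs.foll_contract_iff h hi hij hjd, place_of_eq hy, place_of_ne hij hri hxj,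
      Subtype.ext_iff, hy, h.desc_iff_le_parent hpi, h.desc_iff_le_parent hpj]
  · exact iff_of_false hxj hxi
  · exact ⟨fun hc => h.parent_unique _ _ _ hpj hc ▸ hpi,
      fun hc => h.parent_unique _ _ _ hpi hc ▸ hpj⟩
  · exact foll_spine_iff
  · exact iff_of_false hxj.symm hxi.symm
  · exact iff_of_false (fun hc => hjx (.single hc)) fun hc => hix (.single hc)
  · exact iff_of_false (fun hc => hjx hc.to_reflTransGen) fun hc => hix hc.to_reflTransGen
  · exact iff_of_false (fun hc => not_foll j hij.le hjd (.single hc))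
      fun hc => not_foll i le_rfl (by omega) (.single hc)
  · exact iff_of_false (not_foll j hij.le hjd) (not_foll i le_rfl (by omega))

theorem isContraction [Finite T] (hs : IsRightSpine child next p d c rank)
    (h : IsOrderedTree child next) (hi : 1 ≤ i) (hij : i < j) (hjd : j ≤ d) :
    IsContraction child next c rank i j (fun a b => child a.1 b.1)
      (fun a b => next a.1 (place c b)) where
  isOrderedTree := hs.isOrderedTree_contract h hi hij hjd
  relPos_above _ _ hx hy := hs.relPos_contract_above h hi hij hjd hx hy
  relPos_eq x y hxy hyx := by
    have hdesc : ∀ a b : Kept rank i j,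
        TransGen (fun a b : Kept rank i j => child a.1 b.1) a b ↔ TransGen child a.1 b.1 :=
      fun a b => transGen_onFun_iff fun a b hab => ⟨⟨a, hs.kept_of_child hi hab⟩, rfl⟩
    have hfoll := fun a b : Kept rank i j => hs.foll_contract_iff h hi hij hjd (a := a) (b := b)
    exact relPos_congr
      ⟨Subtype.ext_iff, .rfl, hdesc x y, hs.next_place_iff h hi hij hjd hxy, hfoll x y⟩
      ⟨Subtype.ext_iff, .rfl, hdesc y x, hs.next_place_iff h hi hij hjd hyx, hfoll y x⟩

end IsRightSpine

end RightSpine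

section SmallModels

variable {U : Type u} {C : Type v}

theorem IsContraction.relPos_basePair {T : Type} {child next : T → T → Prop} {d : ℕ}
    {c : ℕ → T} {rank : T → ℕ} {i j : ℕ} {child' next' : Kept rank i j → Kept rank i j → Prop}
    (hk : IsContraction child next c rank i j child' next') (h : IsOrderedTree child next)
    (hs : IsSpine (relPos child next) d c rank) (hi : 1 ≤ i) (hij : i < j) (hjd : j ≤ d)
    (x y : Kept rank i j) :
    relPos child next (basePair rank i (c i) (c j) x y).1 (basePair rank i (c i) (c j) x y).2 =
      relPos child' next' x y := by
  have hrj := hs.rank_spine j (by omega) hjd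
  have above : ∀ x y : Kept rank i j, rank x.1 < i → y.1 = c j →
      relPos child next (basePair rank i (c i) (c j) x y).1
        (basePair rank i (c i) (c j) x y).2 = relPos child' next' x y := by
    intro x y hx hy
    rw [hk.relPos_above x y hx hy]
    by_cases hxi : rank x.1 + 1 = i
    · rw [basePair, if_pos ⟨hxi, hy⟩]
    · have hxj : x.1 ≠ c j := by rintro e; rw [e] at hx; omega
      rw [basePair_of_not (fun hc => hxi hc.1) fun hc => hxj hc.2, hy,
        hs.pos_eq_of_rank_lt (by omega) hij hjd]
  by_cases hxy : rank x.1 < i ∧ y.1 = c j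
  · exact above x y hxy.1 hxy.2
  by_cases hyx : rank y.1 < i ∧ x.1 = c j
  · rw [hk.isOrderedTree.relPos_flip y x, ← above y x hyx.1 hyx.2,
      basePair_swap (by omega) y.1 x.1, ← h.relPos_flip]
    rfl
  · rw [hk.relPos_eq x y hxy hyx, basePair_of_not (fun hc => hxy ⟨by omega, hc.2⟩)
      fun hc => hyx ⟨by omega, hc.2⟩]

variable (φ : NormalForm U C) {T : TreeStructure U C}

theorem NormalForm.exists_witness_map (hT : Sentence.Realize T.Carrier φ.toSentence) :
    ∃ w : Fin φ.m → T.Carrier → T.Carrier,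
      (∀ k a, T.unary (φ.conjuncts.get k).guard a →
        (φ.conjuncts.get k).IsWitness T a (w k a)) ∧
      ∀ k a b, nodeType φ.toSentence T a = nodeType φ.toSentence T b →
        relPos T.child T.next a (w k a) = relPos T.child T.next b (w k b) := by
  have : ∀ k a, ∃ b, (T.unary (φ.conjuncts.get k).guard a →
      (φ.conjuncts.get k).IsWitness T a b) ∧ (¬ T.unary (φ.conjuncts.get k).guard a → b = a) := by
    intro k a
    by_cases ha : T.unary (φ.conjuncts.get k).guard a
    · obtain ⟨b, hb⟩ := ((φ.realize_toSentence T).1 hT).2 _ (φ.conjuncts.get_mem k) a ha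
      exact ⟨b, fun _ => hb, fun hc => absurd ha hc⟩
    · exact ⟨a, fun hc => absurd hc ha, fun _ => rfl⟩
  choose w hw hw' using this
  refine ⟨w, hw, fun k a b hab => ?_⟩
  have hguard := φ.guard_iff_of_nodeType_eq (φ.conjuncts.get_mem k) hab
  by_cases ha : T.unary (φ.conjuncts.get k).guard a
  · rw [(hw k a ha).1, (hw k b (hguard.1 ha)).1]
  · rw [hw' k a ha, hw' k b (hguard.not.1 ha), relPos_self, relPos_self]

theorem NormalForm.exists_smaller_model (hm : 0 < φ.m)
    (hT : Sentence.Realize T.Carrier φ.toSentence) {d : ℕ} {c : ℕ → T.Carrier}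
    {rank : T.Carrier → ℕ} (hs : IsSpine (relPos T.child T.next) d c rank) (hd : φ.bound ≤ d)
    (hcontract : ∀ i j, 2 ≤ i → i < j → j ≤ d →
      ∃ child' next', IsContraction T.child T.next c rank i j child' next') :
    ∃ T' : TreeStructure U C, Nat.card T'.Carrier < Nat.card T.Carrier ∧
      Sentence.Realize T'.Carrier φ.toSentence := by
  have := T.finite
  have := (oneTypes_finite φ.toSentence).fintype
  obtain ⟨w, hw, hwpos⟩ := φ.exists_witness_map hT
  obtain ⟨i, j, π, hi, hij, hjd, htype, hπ⟩ := hs.exists_isRerouting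
    (fun a => (⟨_, nodeType_mem_oneTypes φ.toSentence T a⟩ : oneTypes φ.toSentence)) w
    T.isTree.relPos_flip (fun k a b hab => hwpos k a b (Subtype.ext_iff.1 hab)) hm
    (by rwa [← Nat.card_eq_fintype_card])
  obtain ⟨child', next', hk⟩ := hcontract i j hi hij hjd
  have assignment : IsTypeAssignment φ.toSentence T child' next' Subtype.val
      fun x y : Kept rank i j => π x y :=
    { swap := fun x y => hπ.swap x y
      self := fun x => hπ.self x
      nodeType_fst := fun x y => Subtype.ext_iff.1 (hπ.type_fst x y)
      relPos_eq := fun x y => (hπ.pos_eq x y).trans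
        (hk.relPos_basePair T.isTree hs (by omega) hij hjd x y) }
  refine ⟨T.pullback hk.isOrderedTree _ _, Finite.card_subtype_lt (x := c i) ?_,
    assignment.realize_pullback hT fun r hr x hx => ?_⟩
  · rw [not_not, hs.rank_spine i (by omega) (by omega)]
    exact ⟨le_rfl, hij⟩
  · obtain ⟨k, rfl⟩ := List.mem_iff_get.1 hr
    obtain ⟨y, hy, e | ⟨hxj, e⟩⟩ := hπ.exists_witness x x.2 k
    all_goals refine ⟨⟨y, hy⟩, ?_⟩; rw [e]
    · exact hw k x hx
    · exact hw k (c i) ((φ.guard_iff_of_nodeType_eq hr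
        (by rw [hxj]; exact Subtype.ext_iff.1 htype)).2 hx)

theorem NormalForm.length_le_bound (hm : 0 < φ.m) (hT : Sentence.Realize T.Carrier φ.toSentence)
    (hmin : ∀ T' : TreeStructure U C, Sentence.Realize T'.Carrier φ.toSentence →
      Nat.card T.Carrier ≤ Nat.card T'.Carrier) {P : List T.Carrier} (hP : T.IsDownPath P) :
    P.length ≤ φ.bound := by
  have := T.finite
  by_contra! hlt
  let c : ℕ → T.Carrier := fun l => if hl : l - 1 < P.length then P[l - 1] else P[0]
  have hc : ∀ l (hl : l - 1 < P.length), c l = P[l - 1] := fun l hl => dif_pos hl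
  have child_succ : ∀ l, 1 ≤ l → l < P.length → T.child (c l) (c (l + 1)) := by
    intro l hl hld
    rw [hc l (by omega), hc (l + 1) (by omega)]
    simpa only [Nat.sub_add_cancel hl, Nat.add_sub_cancel] using
      List.isChain_iff_getElem.1 hP (l - 1) (by omega)
  obtain ⟨rank, hs⟩ := exists_isDownSpine child_succ
  obtain ⟨T', hlt', hT'⟩ := φ.exists_smaller_model hm hT (hs.isSpine T.isTree) hlt.le
    fun i j hi hij hjd => ⟨_, _, hs.isContraction T.isTree hi hij hjd⟩
  exact (hmin T' hT').not_gt hlt'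

theorem NormalForm.degree_le_bound (hm : 0 < φ.m) (hT : Sentence.Realize T.Carrier φ.toSentence)
    (hmin : ∀ T' : TreeStructure U C, Sentence.Realize T'.Carrier φ.toSentence →
      Nat.card T.Carrier ≤ Nat.card T'.Carrier) (a : T.Carrier) : T.degree a ≤ φ.bound := by
  have := T.finite
  by_contra! hlt
  obtain ⟨c, rank, hs⟩ := exists_isRightSpine T.isTree a
  obtain ⟨T', hlt', hT'⟩ := φ.exists_smaller_model hm hT (hs.isSpine T.isTree) hlt.le
    fun i j hi hij hjd => ⟨_, _, hs.isContraction T.isTree (by omega) hij hjd⟩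
  exact (hmin T' hT').not_gt hlt'

theorem isOrderedTree_unit : IsOrderedTree (fun _ _ : Unit => False) (fun _ _ : Unit => False) where
  exists_root := ⟨(), fun _ => id, fun _ => .refl⟩
  parent_unique _ _ _ h := h.elim
  next_siblings _ _ h := h.elim
  next_unique _ _ _ h := h.elim
  foll_irrefl _ h := let ⟨_, _, hc⟩ := TransGen.tail'_iff.1 h; hc
  foll_total _ _ _ h := h.elim

theorem NormalForm.exists_singleton_model (hm : φ.m = 0)
    (hT : Sentence.Realize T.Carrier φ.toSentence) :
    ∃ T' : TreeStructure U C, Subsingleton T'.Carrier ∧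
      Sentence.Realize T'.Carrier φ.toSentence := by
  obtain ⟨r, -⟩ := T.isTree.exists_root
  have assignment : IsTypeAssignment φ.toSentence T (fun _ _ : Unit => False)
      (fun _ _ => False) (fun _ => r) fun _ _ => (r, r) :=
    { swap := fun _ _ => rfl
      self := fun _ => rfl
      nodeType_fst := fun _ _ => rfl
      relPos_eq := fun _ _ => (relPos_self _).trans (relPos_self (T := Unit) _).symm }
  refine ⟨T.pullback isOrderedTree_unit _ _, inferInstanceAs (Subsingleton Unit),
    assignment.realize_pullback hT fun c hc => ?_⟩
  rw [List.length_eq_zero_iff.1 hm] at hc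
  exact absurd hc List.not_mem_nil

theorem TreeStructure.degree_eq_zero [Subsingleton T.Carrier] (a : T.Carrier) :
    T.degree a = 0 := by
  have no_child : {b | T.child a b} = ∅ := Set.eq_empty_of_forall_notMem fun b hb =>
    T.isTree.desc_irrefl a (.single (Subsingleton.elim b a ▸ hb))
  rw [TreeStructure.degree, no_child, Set.ncard_empty]

theorem NormalForm.exists_bounded_model (hφ : Satisfiable φ.toSentence) :
    ∃ T : TreeStructure U C, Sentence.Realize T.Carrier φ.toSentence ∧
      (0 < φ.m → ∀ P : List T.Carrier, T.IsDownPath P → P.length ≤ φ.bound) ∧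
      ∀ a : T.Carrier, T.degree a ≤ φ.bound := by
  rcases Nat.eq_zero_or_pos φ.m with hm | hm
  · obtain ⟨T, hT⟩ := hφ
    obtain ⟨T', _, hT'⟩ := φ.exists_singleton_model hm hT
    exact ⟨T', hT', fun h => absurd hm h.ne', fun a => by
      rw [TreeStructure.degree_eq_zero a]; exact Nat.zero_le _⟩
  · obtain ⟨T, hT, hmin⟩ := exists_minimalFor_of_wellFoundedLT _
      (fun T : TreeStructure U C => Nat.card T.Carrier) hφ
    have card_le : ∀ T' : TreeStructure U C, Sentence.Realize T'.Carrier φ.toSentence →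
        Nat.card T.Carrier ≤ Nat.card T'.Carrier :=
      fun T' hT' => (le_total _ _).elim id (hmin hT')
    exact ⟨T, hT, fun _ _ => φ.length_le_bound hm hT card_le, φ.degree_le_bound hm hT card_le⟩

end SmallModels

end TreeFO2

theorem theorem2 :
    (∃ c : ℕ, ∀ (U : Type*) (C : Type*) (φ : TreeFO2.NormalForm U C),
      φ.bound ≤ 2 ^ (c * TreeFO2.size φ.toSentence)) ∧
    ∀ (U : Type*) (C : Type*) (φ : TreeFO2.NormalForm U C),
      TreeFO2.Satisfiable φ.toSentence →
        ∃ T : TreeFO2.TreeStructure U C,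
          FirstOrder.Language.Sentence.Realize T.Carrier φ.toSentence ∧
          (0 < φ.m → ∀ P : List T.Carrier, T.IsDownPath P → P.length ≤ φ.bound) ∧
          (∀ a : T.Carrier, T.degree a ≤ φ.bound) :=
  ⟨⟨13, fun _ _ φ => φ.bound_le⟩, fun _ _ φ hφ => φ.exists_bounded_model hφ⟩
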